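/- Let $(X,\mu)$ be a measure space and let $A$ be a positive (i.e. nonnegative, possibly unbounded) self-adjoint operator on the complex Hilbert space $L^2(X,\mu)$, with spectral projections $\Pi_{]0,\lambda]}=\chi_A(]0,\lambda])$ and $\Pi_{[0,\lambda]}=\chi_A([0,\lambda])$, $\lambda\ge 0$. For a bounded operator $T$ on $L^2$ put $\|T\|_{1,\infty}=\sup\{\|Tg\|_\infty : g\in L^1\cap L^2,\ \|g\|_1\le 1\}\in[0,\infty]$. Let $\mathcal E(f)=\langle Af,f\rangle=\|A^{1/2}f\|_2^2\in[0,\infty]$ be the energy of $f\in L^2$ (equal to $+\infty$ if $f$ is not in the domain of $A^{1/2}$). For $F:[0,\infty)\to[0,\infty]$ nondecreasing and $y \in [0,\infty]$ let $F^{-1}(y)=\sup\{\lambda\ge0 : F(\lambda)\le y\}\in[0,\infty]$, with $F^{-1}(y)=0$ if the set is empty. The convention $0\cdot\infty=0$ is used, and $1/\|f\|_1=0$ if $f\notin L^1$. Suppose either * $f\in L^2(X)\cap(\ker A)^\perp$, $f\ne0$, and $F(\lambda)=\|\Pi_{]0,\lambda]}\|_{1,\infty}$; or * $f\in L^2(X)$,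 $f\neq0$, is arbitrary and $F(\lambda)=\|\Pi_{[0,\lambda]}\|_{1,\infty}$. Then: 1. (Moser inequalities) $$\int_X|f|^2F^{-1}\Bigl(\frac{|f|^2}{4\|f\|_2^2}\Bigr)d\mu\le4\,\mathcal E(f)\qquad (a),\qquad \int_X|f|^2F^{-1}\Bigl(\frac{|f|}{2\|f\|_1}\Bigr)d\mu\le4\,\mathcal E(f)\qquad (b).$$ 2. (Nash-type inequality) $$\|f\|_2^2\,F^{-1}\Bigl(\frac{\|f\|_2^2}{4\|f\|_1^2}\Bigr)\le8\,\mathcal E(f)\qquad (c).$$ Each Moser inequality implies a Nash-type inequality: for every nondecreasing $\Phi:[0,\infty)\to[0,\infty]$ and every $e\in[0,\infty]$, if (b) holds with $(\Phi,e)$ in place of $(F,\mathcal E(f))$, then so does (c); and if (a) holds with $(\Phi,e)$ in place of $(F,\mathcal E(f))$, then for all $0<\varepsilon<\frac12$ $$\bigl(\tfrac12-\varepsilon\bigr)\|f\|_2^2\,\Phi^{-1}\Bigl(\frac{\varepsilon^2\|f\|_2^2}{\|f\|_1^2}\Bigr)\le2e.$$ 3. (Faber–Krahn inequality) If moreover $f$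 vanishes almost everywhere outside a measurable set $\Omega$ with $\mu(\Omega)<\infty$ and $\mathcal E(f)<\infty$, then $$4\,\mu(\Omega)\,F\Bigl(\frac{8\,\mathcal E(f)}{\|f\|_2^2}\Bigr)\ge1.$$ -/

import Mathlib

open MeasureTheory Filter Topology
open scoped ENNReal NNReal

noncomputable section

/-- A (right-continuous) resolution of the identity, i.e. a spectral family `(E_u)_{u ∈ ℝ}` of
orthogonal projections, on a complex Hilbert space. -/
structure ResolutionOfIdentity (H : Type*) [NormedAddCommGroup H] [InnerProductSpace ℂ H]
    [CompleteSpace H] where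
  toFun : ℝ → H →L[ℂ] H
  isProj : ∀ u, IsStarProjection (toFun u)
  mono : ∀ u v, u ≤ v → ∀ f, toFun u (toFun v f) = toFun u f
  rightCont : ∀ u f, Tendsto (fun v => toFun v f) (𝓝[>] u) (𝓝 (toFun u f))
  tendsto_bot : ∀ f, Tendsto (fun v => toFun v f) atBot (𝓝 0)
  tendsto_top : ∀ f, Tendsto (fun v => toFun v f) atTop (𝓝 f)

namespace ResolutionOfIdentity

variable {H : Type*} [NormedAddCommGroup H] [InnerProductSpace ℂ H] [CompleteSpace H]

theorem norm_apply_le (E : ResolutionOfIdentity H) (u : ℝ) (f : H) : ‖E.toFun u f‖ ≤ ‖f‖ := by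
  have h1 : ‖E.toFun u‖ ≤ 1 := IsStarProjection.norm_le _ (E.isProj u)
  simpa using (E.toFun u).le_of_opNorm_le h1 f

/-- The nondecreasing right-continuous function `u ↦ ‖E_u f‖² = ⟨E_u f, f⟩`. -/
def stieltjes (E : ResolutionOfIdentity H) (f : H) : StieltjesFunction ℝ where
  toFun u := ‖E.toFun u f‖ ^ 2
  mono' := by
    intro u v huv
    have h := E.norm_apply_le u (E.toFun v f)
    rw [E.mono u v huv] at h
    exact pow_le_pow_left₀ (norm_nonneg _) h 2
  right_continuous' := by
    intro u
    rw [← continuousWithinAt_Ioi_iff_Ici]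
    exact ((E.rightCont u f).norm).pow 2

/-- The scalar spectral measure `d⟨E_u f, f⟩` on `ℝ`. -/
def scalarMeasure (E : ResolutionOfIdentity H) (f : H) : Measure ℝ := (E.stieltjes f).measure

/-- `A = ∫ u dE_u`: the domain of `A` is `{f | ∫ u² d⟨E_u f, f⟩ < ∞}`, and on this domain
`⟨A f, f⟩ = ∫ u d⟨E_u f, f⟩` (which determines `A f` by polarization). -/
def Represents (E : ResolutionOfIdentity H) (A : H →ₗ.[ℂ] H) : Prop :=
  (∀ f : H, f ∈ A.domain ↔ ∫⁻ u, ENNReal.ofReal (u ^ 2) ∂(E.scalarMeasure f) < ∞) ∧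
  ∀ f : A.domain,
    inner ℂ (A f) (f : H) = ((∫ u, u ∂(E.scalarMeasure (f : H)) : ℝ) : ℂ)

/-- The spectral family of the zero operator. -/
def trivialResolution (H : Type*) [NormedAddCommGroup H] [InnerProductSpace ℂ H]
    [CompleteSpace H] : ResolutionOfIdentity H where
  toFun u := if 0 ≤ u then 1 else 0
  isProj u := by
    split_ifs
    · exact IsStarProjection.one _
    · exact IsStarProjection.zero _
  mono u v huv f := by
    by_cases hu : 0 ≤ u
    · simp [hu, hu.trans huv]
    · simp [hu]
  rightCont u f := by
    apply tendsto_const_nhds.congr'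
    by_cases hu : 0 ≤ u
    · filter_upwards [self_mem_nhdsWithin] with v hv
      have hv' : 0 ≤ v := hu.trans (le_of_lt hv)
      simp [hu, hv']
    · have : ∀ᶠ v in 𝓝[>] u, v < 0 := (eventually_lt_nhds (not_le.1 hu)).filter_mono
        nhdsWithin_le_nhds
      filter_upwards [this] with v hv
      simp [hu, not_le.2 hv]
  tendsto_bot f := by
    apply tendsto_const_nhds.congr'
    filter_upwards [eventually_lt_atBot (0 : ℝ)] with v hv
    simp [not_le.2 hv]
  tendsto_top f := by
    apply tendsto_const_nhds.congr'
    filter_upwards [eventually_ge_atTop (0 : ℝ)] with v hv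
    simp [hv]

end ResolutionOfIdentity

section Operator

variable {H : Type*} [NormedAddCommGroup H] [InnerProductSpace ℂ H] [CompleteSpace H]

/-- `A` is nonnegative: `⟨A f, f⟩ ≥ 0` on the domain. -/
def OpNonneg (A : H →ₗ.[ℂ] H) : Prop :=
  ∀ f : A.domain, 0 ≤ (inner ℂ (A f) (f : H)).re

/-- The kernel of an unbounded operator, as a subspace of the Hilbert space. -/
def opKer (A : H →ₗ.[ℂ] H) : Submodule ℂ H :=
  (LinearMap.ker A.toFun).map A.domain.subtype

open Classical in
/-- The spectral family of a self-adjoint operator `A`: the (unique) resolution of the identity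
with `A = ∫ u dE_u`. The second branch never occurs for self-adjoint `A`. -/
def spectralFamily (A : H →ₗ.[ℂ] H) : ResolutionOfIdentity H :=
  if h : ∃ E : ResolutionOfIdentity H, E.Represents A then h.choose
  else ResolutionOfIdentity.trivialResolution H

/-- The spectral projection `χ_A(]0, l])`. -/
def spectralProjIoc (A : H →ₗ.[ℂ] H) (l : ℝ≥0) : H →L[ℂ] H :=
  (spectralFamily A).toFun l - (spectralFamily A).toFun 0

/-- The spectral projection `χ_A([0, l])` of a nonnegative operator `A`; the spectrum of such an
operator lies in `[0, ∞[`, so this is `χ_A(]-∞, l]) = E_l`. -/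
def spectralProjIcc (A : H →ₗ.[ℂ] H) (l : ℝ≥0) : H →L[ℂ] H :=
  (spectralFamily A).toFun l

/-- The energy `⟨A f, f⟩ = ‖A^{1/2} f‖² = ∫ u d⟨E_u f, f⟩ ∈ [0, ∞]` of an arbitrary vector `f`,
for a nonnegative self-adjoint `A`; it is infinite outside the form domain. -/
def energy (A : H →ₗ.[ℂ] H) (f : H) : ℝ≥0∞ :=
  ∫⁻ u, ENNReal.ofReal u ∂((spectralFamily A).scalarMeasure f)

end Operator

/-- The ultracontractive norm `‖T‖_{1,∞} ∈ [0, ∞]` of a bounded operator on `L²`: the supremum of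
`‖T f‖_∞` over the `f ∈ L¹ ∩ L²` with `‖f‖₁ ≤ 1`. -/
def norm1Inf {X : Type*} [MeasurableSpace X] {μ : Measure X}
    (T : Lp ℂ 2 μ →L[ℂ] Lp ℂ 2 μ) : ℝ≥0∞ :=
  ⨆ (f : Lp ℂ 2 μ) (_ : eLpNorm f 1 μ ≤ 1), eLpNorm (T f) ∞ μ

/-- The right-continuous inverse `F⁻¹(y) = sup {l ≥ 0 | F(l) ≤ y} ∈ [0, ∞]`, equal to `0` if
there is no such `l`. -/
def rcInv (F : ℝ≥0 → ℝ≥0∞) (y : ℝ≥0∞) : ℝ≥0∞ :=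
  ⨆ (l : ℝ≥0) (_ : F l ≤ y), (l : ℝ≥0∞)

section Inequalities

variable {X : Type*} [MeasurableSpace X] {μ : Measure X}

/-- `∫ |f|² F⁻¹(|f|² / (4 ‖f‖₂²)) dμ ≤ 4 e`. -/
def MoserTwo (F : ℝ≥0 → ℝ≥0∞) (e : ℝ≥0∞) (f : Lp ℂ 2 μ) : Prop :=
  ∫⁻ x, ‖f x‖ₑ ^ 2 * rcInv F (‖f x‖ₑ ^ 2 / (4 * eLpNorm f 2 μ ^ 2)) ∂μ ≤ 4 * e

/-- `∫ |f|² F⁻¹(|f| / (2 ‖f‖₁)) dμ ≤ 4 e`, with `|f| / (2 ‖f‖₁) = 0` if `f ∉ L¹`. -/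
def MoserOne (F : ℝ≥0 → ℝ≥0∞) (e : ℝ≥0∞) (f : Lp ℂ 2 μ) : Prop :=
  ∫⁻ x, ‖f x‖ₑ ^ 2 * rcInv F (‖f x‖ₑ / (2 * eLpNorm f 1 μ)) ∂μ ≤ 4 * e

/-- `‖f‖₂² F⁻¹(‖f‖₂² / (4 ‖f‖₁²)) ≤ 8 e`. -/
def NashIneq (F : ℝ≥0 → ℝ≥0∞) (e : ℝ≥0∞) (f : Lp ℂ 2 μ) : Prop :=
  eLpNorm f 2 μ ^ 2 * rcInv F (eLpNorm f 2 μ ^ 2 / (4 * eLpNorm f 1 μ ^ 2)) ≤ 8 * e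

/-- `(1/2 - ε) ‖f‖₂² F⁻¹(ε² ‖f‖₂² / ‖f‖₁²) ≤ 2 e` for all `0 < ε < 1/2`. -/
def WeakNashIneq (F : ℝ≥0 → ℝ≥0∞) (e : ℝ≥0∞) (f : Lp ℂ 2 μ) : Prop :=
  ∀ ε : ℝ, 0 < ε → ε < 1 / 2 →
    ENNReal.ofReal (1 / 2 - ε) * eLpNorm f 2 μ ^ 2 *
      rcInv F (ENNReal.ofReal (ε ^ 2) * eLpNorm f 2 μ ^ 2 / eLpNorm f 1 μ ^ 2) ≤ 2 * e

end Inequalities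

end

/-! Let `E` be the spectral family of `A`, and let `T l` be the projection `χ_A(]0, l])` or `χ_A([0,
l])`. In both cases `T l f = E_l f`; in the first because `f ⊥ ker A` forces `E_0 f = 0`. The
layer-cake formula gives `energy A f = ∫_0^∞ ‖f - E_t f‖² dt`. At points where `F t ≤ y x`, with `y`
the argument of `F⁻¹`, an ultracontractive bound gives `|T t f| ≤ |f| / 2`, hence `|f| ≤ 2 |f - T t
f|`, and so `∫_{F t ≤ y} |f|² ≤ 4 ‖f - T t f‖²`. Integrating in `t` and exchanging the integrals
yields both Moser inequalities (`lintegral_mul_rcInv_le`, `moser_of_pointwise`), since the length of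
`{t > 0 | F t ≤ y x}` is at least `F⁻¹(y x)`.

The pointwise bound for (b) is `‖T f‖_∞ ≤ F ‖f‖₁`. For (a) it is `‖T f‖_∞² ≤ F ‖f‖₂²`, which follows
by duality from `‖T g‖₂² = ⟨T g, g⟩ ≤ F ‖g‖₁²`. The Nash inequalities come from discarding the part
of `f` below a suitable height (`mul_rcInv_le_of_lintegral_le`). Faber–Krahn combines Chebyshev for
the spectral measure, the `L¹ → L²` bound for `T l`, and Cauchy–Schwarz on `Ω`.

Since `spectralFamily` is chosen from an existence statement, the spectral theorem is proved as well
(`exists_represents`); it serves to obtain `E_0 f = 0`. The family is `E_u = χ_R([1/(1+u), ∞[)` for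
`u ≥ 0`, with `R = (1 + A)⁻¹` bounded, so that the continuous functional calculus supplies the
projections. -/

noncomputable section

/-! ### Spectral projections of a bounded self-adjoint operator. -/

section BoundedSpectral

variable {H : Type*} [NormedAddCommGroup H] [InnerProductSpace ℂ H]

theorem re_inner_smul_sub {R : H →L[ℂ] H} (t : ℝ) (k : H) :
    (inner ℂ (((t : ℂ) • (1 : H →L[ℂ] H) - R) k) k).re = t * ‖k‖ ^ 2 - (inner ℂ (R k) k).re := by
  simp only [sub_apply, smul_apply,
    one_apply_eq_self, inner_sub_left, inner_smul_left, Complex.sub_re,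
    Complex.conj_ofReal, Complex.re_ofReal_mul]
  congr 2
  exact inner_self_eq_norm_sq (𝕜 := ℂ) k

variable [CompleteSpace H]

/-- The operator `(t - R)₊`. -/
def cutoffBelow (R : H →L[ℂ] H) (t : ℝ) : H →L[ℂ] H := cfc (fun x : ℝ => max (t - x) 0) R

/-- The operator `(R - t)₊`. -/
def cutoffAbove (R : H →L[ℂ] H) (t : ℝ) : H →L[ℂ] H := cfc (fun x : ℝ => max (x - t) 0) R

/-- The range of the spectral projection `χ_R([t, ∞[)`. -/
def upperSpace (R : H →L[ℂ] H) (t : ℝ) : Submodule ℂ H := (cutoffBelow R t).ker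

theorem mem_upperSpace {R : H →L[ℂ] H} {t : ℝ} {k : H} :
    k ∈ upperSpace R t ↔ cutoffBelow R t k = 0 := Iff.rfl

instance (R : H →L[ℂ] H) (t : ℝ) : CompleteSpace (upperSpace R t) :=
  (cutoffBelow R t).isClosed_ker.completeSpace_coe

theorem cutoffBelow_isPositive (R : H →L[ℂ] H) (t : ℝ) : (cutoffBelow R t).IsPositive := by
  rw [← ContinuousLinearMap.nonneg_iff_isPositive]
  exact cfc_nonneg fun _ _ => le_max_right _ _

theorem cutoffAbove_isPositive (R : H →L[ℂ] H) (t : ℝ) : (cutoffAbove R t).IsPositive := by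
  rw [← ContinuousLinearMap.nonneg_iff_isPositive]
  exact cfc_nonneg fun _ _ => le_max_right _ _

theorem cutoffBelow_sub_cutoffAbove {R : H →L[ℂ] H} (hR : IsSelfAdjoint R) (t : ℝ) :
    cutoffBelow R t - cutoffAbove R t = (t : ℂ) • 1 - R := by
  have h1 : cutoffBelow R t - cutoffAbove R t = cfc (fun x : ℝ => t - x) R := by
    rw [cutoffBelow, cutoffAbove, ← cfc_sub ..]
    refine cfc_congr fun x _ => ?_
    rcases le_total x t with h | h
    · simp [h]
    · simp [h]
  rw [h1, cfc_sub .., cfc_const t R, cfc_id' ℝ R, Algebra.algebraMap_eq_smul_one]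
  rfl

theorem cutoffBelow_mul_cutoffAbove (R : H →L[ℂ] H) (t : ℝ) :
    cutoffBelow R t * cutoffAbove R t = 0 := by
  rw [cutoffBelow, cutoffAbove, ← cfc_mul ..]
  rw [show (fun x : ℝ => max (t - x) 0 * max (x - t) 0) = fun _ => 0 from ?_]
  · simp
  · ext x
    rcases le_total x t with h | h
    · simp [h]
    · simp [h]

/-- `(s - x)₊` is a continuous multiple of `(t - x)₊`: the denominator `max (t - x) (t - s)` stays
at least `t - s > 0`, and equals `t - x` wherever the numerator is nonzero. -/
theorem upperSpace_anti (R : H →L[ℂ] H) {s t : ℝ} (hst : s ≤ t) :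
    upperSpace R t ≤ upperSpace R s := by
  rcases hst.eq_or_lt with rfl | hlt
  · exact le_rfl
  intro k hk
  have h : cutoffBelow R s =
      cfc (fun x : ℝ => max (s - x) 0 / max (t - x) (t - s)) R * cutoffBelow R t := by
    have hne : ∀ x : ℝ, max (t - x) (t - s) ≠ 0 := fun x =>
      (lt_of_lt_of_le (sub_pos.2 hlt) (le_max_right _ _)).ne'
    have hc : ContinuousOn (fun x : ℝ => max (s - x) 0 / max (t - x) (t - s)) (spectrum ℝ R) :=
      Continuous.continuousOn (Continuous.div (by fun_prop) (by fun_prop) hne)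
    rw [cutoffBelow, cutoffBelow, ← cfc_mul _ _ R hc (by fun_prop)]
    refine cfc_congr fun x _ => ?_
    rcases le_total x s with hx | hx
    · have h1 : 0 < t - x := by linarith
      have h2 : t - s ≤ t - x := by linarith
      simp only [max_eq_left h2, max_eq_left h1.le]
      field_simp
    · have h1 : s - x ≤ 0 := by linarith
      simp [max_eq_right h1]
  rw [mem_upperSpace] at hk ⊢
  rw [h, mul_apply_eq_comp, hk, map_zero]

theorem norm_cutoffBelow_sub_le (R : H →L[ℂ] H) (s t : ℝ) :
    ‖cutoffBelow R t - cutoffBelow R s‖ ≤ |t - s| := by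
  rw [cutoffBelow, cutoffBelow, ← cfc_sub ..]
  refine norm_cfc_le (abs_nonneg _) fun x _ => ?_
  have := abs_max_sub_max_le_abs (t - x) (s - x) 0
  simpa using this

/-- `t ↦ (t - R)₊` is 1-Lipschitz in norm, so the kernel condition passes to limits. Right
continuity of the spectral family rests on this. -/
theorem mem_upperSpace_of_forall_lt {R : H →L[ℂ] H} {t : ℝ} {k : H} {T : Set ℝ}
    (hT : t ∈ closure T) (h : ∀ s ∈ T, k ∈ upperSpace R s) : k ∈ upperSpace R t := by
  rw [mem_upperSpace, ← norm_le_zero_iff]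
  refine le_of_forall_pos_le_add fun ε hε => ?_
  obtain ⟨s, hs, hst⟩ := Metric.mem_closure_iff.1 hT (ε / (‖k‖ + 1)) (by positivity)
  have h0 : cutoffBelow R s k = 0 := h s hs
  calc ‖cutoffBelow R t k‖ = ‖(cutoffBelow R t - cutoffBelow R s) k‖ := by simp [h0]
    _ ≤ ‖cutoffBelow R t - cutoffBelow R s‖ * ‖k‖ := ContinuousLinearMap.le_opNorm _ _
    _ ≤ |t - s| * ‖k‖ := by gcongr; exact norm_cutoffBelow_sub_le R s t
    _ ≤ ε / (‖k‖ + 1) * (‖k‖ + 1) := by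
        gcongr
        · exact hst.le
        · linarith
    _ = 0 + ε := by field_simp; ring

theorem le_re_inner_of_mem_upperSpace {R : H →L[ℂ] H} (hR : IsSelfAdjoint R) {t : ℝ} {k : H}
    (hk : k ∈ upperSpace R t) : t * ‖k‖ ^ 2 ≤ (inner ℂ (R k) k).re := by
  have h := re_inner_smul_sub (R := R) t k
  have h0 : cutoffBelow R t k = 0 := hk
  rw [← cutoffBelow_sub_cutoffAbove hR, sub_apply, h0, zero_sub,
    inner_neg_left, Complex.neg_re] at h
  have h2 : 0 ≤ (inner ℂ (cutoffAbove R t k) k).re :=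
    (cutoffAbove_isPositive R t).re_inner_nonneg_left k
  linarith

theorem re_inner_le_of_mem_orthogonal_upperSpace {R : H →L[ℂ] H} (hR : IsSelfAdjoint R) {t : ℝ}
    {k : H} (hk : k ∈ (upperSpace R t)ᗮ) : (inner ℂ (R k) k).re ≤ t * ‖k‖ ^ 2 := by
  have h0 : cutoffAbove R t k = 0 := by
    -- As `(t - R)₊ (R - t)₊ = 0`, the range of `(R - t)₊` lies in `upperSpace R t`; hence `‖(R -
    -- t)₊ k‖² = ⟨(R - t)₊² k, k⟩ = 0`.
    have hmem : cutoffAbove R t (cutoffAbove R t k) ∈ upperSpace R t := by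
      rw [mem_upperSpace, ← mul_apply_eq_comp, cutoffBelow_mul_cutoffAbove]
      rfl
    have h1 : inner ℂ (cutoffAbove R t (cutoffAbove R t k)) k = 0 :=
      Submodule.inner_right_of_mem_orthogonal hmem hk
    have h2 := (cutoffAbove_isPositive R t).isSymmetric (cutoffAbove R t k) k
    simp only [ContinuousLinearMap.coe_coe] at h2
    rw [h1] at h2
    exact inner_self_eq_zero.1 h2.symm
  have h := re_inner_smul_sub (R := R) t k
  rw [← cutoffBelow_sub_cutoffAbove hR, sub_apply, h0, sub_zero] at h
  have h2 : 0 ≤ (inner ℂ (cutoffBelow R t k) k).re :=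
    (cutoffBelow_isPositive R t).re_inner_nonneg_left k
  linarith

/-- On the range of `χ_R([t, ∞[)` with `t > 0` the operator `R` is invertible. -/
theorem exists_apply_eq_of_mem_upperSpace {R : H →L[ℂ] H} (hR : IsSelfAdjoint R) {t : ℝ}
    (ht : 0 < t) {k : H} (hk : k ∈ upperSpace R t) : ∃ h, R h = k := by
  have hne : ∀ x : ℝ, max x t ≠ 0 := fun x => (lt_of_lt_of_le ht (le_max_right _ _)).ne'
  have hc : ContinuousOn (fun x : ℝ => (max x t)⁻¹) (spectrum ℝ R) :=
    Continuous.continuousOn (Continuous.inv₀ (by fun_prop) hne)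
  refine ⟨cfc (fun x : ℝ => (max x t)⁻¹) R k, ?_⟩
  -- The function `1 / max x t` inverts `x` on `[t, ∞[`, and the defect is a multiple of `(t - x)₊`,
  -- which vanishes on `k`.
  have h1 : R * cfc (fun x : ℝ => (max x t)⁻¹) R = 1 - t⁻¹ • cutoffBelow R t := by
    conv_lhs => enter [1]; rw [← cfc_id' ℝ R]
    rw [← cfc_mul _ _ R (by fun_prop) hc, cutoffBelow, ← cfc_smul _ _ R (by fun_prop),
      ← cfc_one ℝ R, ← cfc_sub _ _ R (by fun_prop) (by fun_prop)]
    refine cfc_congr fun x _ => ?_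
    rcases le_total x t with h | h
    · simp [h]; field_simp; ring
    · have : x ≠ 0 := (ht.trans_le h).ne'
      simp [h, this]
  have h2 := congrArg (fun T : H →L[ℂ] H => T k) h1
  have h0 : cutoffBelow R t k = 0 := hk
  simpa [h0] using h2

/-- An operator commuting with `R` commutes with the spectral projections of `R`. -/
theorem starProjection_upperSpace_comm {R S : H →L[ℂ] H} (hR : IsSelfAdjoint R)
    (hS : IsSelfAdjoint S) (h : Commute R S) (t : ℝ) (k : H) :
    (upperSpace R t).starProjection (S k) = S ((upperSpace R t).starProjection k) := by
  have hc : Commute (cutoffBelow R t) S := Commute.cfc h (by rwa [hR.star_eq]) _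
  have hinv : ∀ x ∈ upperSpace R t, S x ∈ upperSpace R t := by
    intro x hx
    have h0 : cutoffBelow R t x = 0 := hx
    rw [mem_upperSpace, ← mul_apply_eq_comp, hc.eq,
      mul_apply_eq_comp, h0, map_zero]
  have hsymm : ∀ x y : H, inner ℂ (S x) y = inner ℂ x (S y) :=
    (ContinuousLinearMap.isSelfAdjoint_iff_isSymmetric.1 hS)
  refine Submodule.eq_starProjection_of_mem_of_inner_eq_zero
    (hinv _ (Submodule.starProjection_apply_mem _ k)) fun w hw => ?_
  rw [← map_sub, hsymm]
  exact Submodule.starProjection_inner_eq_zero _ _ (hinv w hw)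

/-- The root turns `⟨R k, k⟩` into `‖S k‖²`, so that forms of `R` become total masses of spectral
measures. -/
theorem exists_sqrt {R : H →L[ℂ] H} (hR : R.IsPositive) :
    ∃ S : H →L[ℂ] H, IsSelfAdjoint S ∧ Commute R S ∧ S * S = R := by
  have h0 : 0 ≤ R := (ContinuousLinearMap.nonneg_iff_isPositive R).2 hR
  have hsa : IsSelfAdjoint R := hR.isSelfAdjoint
  refine ⟨cfc Real.sqrt R, IsSelfAdjoint.cfc, ?_, ?_⟩
  · simpa [cfc_id ℝ R] using cfc_commute_cfc (id : ℝ → ℝ) Real.sqrt R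
  · rw [← cfc_mul ..]
    conv_rhs => rw [← cfc_id' ℝ R]
    exact cfc_congr fun x hx => Real.mul_self_sqrt (spectrum_nonneg_of_nonneg h0 hx)

end BoundedSpectral

/-! ### The resolvent of a nonnegative self-adjoint operator. -/

section Resolvent

variable {H : Type*} [NormedAddCommGroup H] [InnerProductSpace ℂ H]

/-- The map `1 + A` on the domain of `A`. -/
def LinearPMap.oneAdd (A : H →ₗ.[ℂ] H) : A.domain →ₗ[ℂ] H := A.toFun + A.domain.subtype

theorem LinearPMap.oneAdd_apply (A : H →ₗ.[ℂ] H) (x : A.domain) :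
    A.oneAdd x = A x + (x : H) := rfl

theorem LinearPMap.norm_sq_le_re_inner_oneAdd {A : H →ₗ.[ℂ] H} (hpos : OpNonneg A)
    (x : A.domain) : ‖(x : H)‖ ^ 2 ≤ (inner ℂ (A.oneAdd x) (x : H)).re := by
  rw [LinearPMap.oneAdd_apply, inner_add_left, Complex.add_re]
  have h : (inner ℂ (x : H) (x : H)).re = ‖(x : H)‖ ^ 2 := inner_self_eq_norm_sq (𝕜 := ℂ) (x : H)
  linarith [hpos x]

theorem LinearPMap.norm_le_norm_oneAdd {A : H →ₗ.[ℂ] H} (hpos : OpNonneg A)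
    (x : A.domain) : ‖(x : H)‖ ≤ ‖A.oneAdd x‖ := by
  have h1 := LinearPMap.norm_sq_le_re_inner_oneAdd hpos x
  have h2 : (inner ℂ (A.oneAdd x) (x : H)).re ≤ ‖A.oneAdd x‖ * ‖(x : H)‖ :=
    re_inner_le_norm (𝕜 := ℂ) _ _
  rcases (norm_nonneg (x : H)).eq_or_lt with h | h
  · rw [← h]; exact norm_nonneg _
  · exact le_of_mul_le_mul_right (by nlinarith) h

variable [CompleteSpace H]

theorem LinearPMap.inner_apply_comm {A : H →ₗ.[ℂ] H} (hA : IsSelfAdjoint A) (x y : A.domain) :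
    inner ℂ (A x) (y : H) = inner ℂ (x : H) (A y) := by
  have h := LinearPMap.adjoint_isFormalAdjoint (T := A) hA.dense_domain
  rw [LinearPMap.isSelfAdjoint_def.1 hA] at h
  exact h x y

theorem LinearPMap.exists_apply_eq_of_forall_inner {A : H →ₗ.[ℂ] H} (hA : IsSelfAdjoint A)
    {y w : H} (h : ∀ x : A.domain, inner ℂ w (x : H) = inner ℂ y (A x)) :
    ∃ z : A.domain, (z : H) = y ∧ A z = w := by
  have hmem := LinearPMap.mem_adjoint_domain_of_exists (T := A) y ⟨w, h⟩
  have happ := LinearPMap.adjoint_apply_eq (T := A) hA.dense_domain ⟨y, hmem⟩ h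
  -- With a generic `B` in place of the adjoint, the equation `B = A` can be substituted although
  -- the argument carries a membership proof.
  have key : ∀ B : H →ₗ.[ℂ] H, B = A → ∀ hy : y ∈ B.domain, B ⟨y, hy⟩ = w →
      ∃ z : A.domain, (z : H) = y ∧ A z = w := by
    rintro B rfl hy hB
    exact ⟨⟨y, hy⟩, rfl, hB⟩
  exact key _ (LinearPMap.isSelfAdjoint_def.1 hA) hmem happ

/-- `1 + A` is bounded below, so convergent images have Cauchy preimages, and the graph of `A` is
closed. -/
theorem LinearPMap.isClosed_range_oneAdd {A : H →ₗ.[ℂ] H} (hA : IsSelfAdjoint A)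
    (hpos : OpNonneg A) : _root_.IsClosed (LinearMap.range A.oneAdd : Set H) := by
  refine isClosed_of_closure_subset fun h hh => ?_
  obtain ⟨y, hy, hlim⟩ := mem_closure_iff_seq_limit.1 hh
  choose x hx using hy
  have hcauchy : CauchySeq fun n => (x n : H) := by
    rw [cauchySeq_iff_tendsto_dist_atTop_0]
    have h1 := cauchySeq_iff_tendsto_dist_atTop_0.1 hlim.cauchySeq
    refine squeeze_zero (fun _ => dist_nonneg) (fun n => ?_) h1
    have := LinearPMap.norm_le_norm_oneAdd hpos (x n.1 - x n.2)
    rw [_root_.map_sub, hx, hx] at this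
    simpa [dist_eq_norm] using this
  obtain ⟨z, hz⟩ := cauchySeq_tendsto_of_complete hcauchy
  have hAx : Tendsto (fun n => A (x n)) atTop (𝓝 (h - z)) := by
    refine (hlim.sub hz).congr fun n => ?_
    rw [← hx n, LinearPMap.oneAdd_apply, add_sub_cancel_right]
  have hgraph : (z, h - z) ∈ A.graph :=
    (IsSelfAdjoint.isClosed hA).mem_of_tendsto (hz.prodMk_nhds hAx)
      (Eventually.of_forall fun n => A.mem_graph (x n))
  obtain ⟨w, hw1, hw2⟩ := (LinearPMap.mem_graph_iff A).1 hgraph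
  refine ⟨w, ?_⟩
  simp only at hw1 hw2
  rw [LinearPMap.oneAdd_apply, hw1, hw2, sub_add_cancel]

/-- A vector `y` orthogonal to the closed range lies in the domain of the adjoint, which is `A`,
with `A y = -y`; nonnegativity then forces `y = 0`. -/
theorem LinearPMap.range_oneAdd {A : H →ₗ.[ℂ] H} (hA : IsSelfAdjoint A)
    (hpos : OpNonneg A) : LinearMap.range A.oneAdd = ⊤ := by
  rw [← (LinearPMap.isClosed_range_oneAdd hA hpos).submodule_topologicalClosure_eq,
    Submodule.topologicalClosure_eq_top_iff, Submodule.eq_bot_iff]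
  intro y hy
  obtain ⟨z, rfl, hz⟩ := LinearPMap.exists_apply_eq_of_forall_inner hA (y := y) (w := -y) (by
    intro x
    have h1 : inner ℂ y (A.oneAdd x) = 0 := Submodule.inner_left_of_mem_orthogonal
      (LinearMap.mem_range_self _ x) hy
    rw [LinearPMap.oneAdd_apply, inner_add_right] at h1
    rw [inner_neg_left]
    linear_combination -h1)
  have h1 := LinearPMap.norm_sq_le_re_inner_oneAdd hpos z
  rw [LinearPMap.oneAdd_apply, hz, neg_add_cancel, inner_zero_left, Complex.zero_re] at h1
  exact norm_eq_zero.1 (pow_eq_zero_iff two_ne_zero |>.1 (le_antisymm h1 (by positivity)))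

/-- The resolvent `R = (1 + A)⁻¹` of a nonnegative self-adjoint operator. -/
theorem LinearPMap.exists_resolvent {A : H →ₗ.[ℂ] H} (hA : IsSelfAdjoint A)
    (hpos : OpNonneg A) : ∃ R : H →L[ℂ] H, R.IsPositive ∧
      (∀ h, (inner ℂ (R h) h).re ≤ ‖h‖ ^ 2) ∧ (∀ h, R h = 0 → h = 0) ∧
      (∀ h, ∃ x : A.domain, (x : H) = R h ∧ A x = h - R h) ∧
      (∀ x : A.domain, ∃ h, R h = x) := by
  have hinj : Function.Injective A.oneAdd := by
    rw [← LinearMap.ker_eq_bot, LinearMap.ker_eq_bot']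
    intro x hx
    have h1 := LinearPMap.norm_le_norm_oneAdd hpos x
    rw [hx, norm_zero] at h1
    exact Subtype.ext (norm_le_zero_iff.1 h1)
  let e : A.domain ≃ₗ[ℂ] H :=
    LinearEquiv.ofBijective A.oneAdd ⟨hinj, LinearMap.range_eq_top.1 (LinearPMap.range_oneAdd hA hpos)⟩
  have he : ∀ h, A.oneAdd (e.symm h) = h := fun h => e.apply_symm_apply h
  let R : H →L[ℂ] H := LinearMap.mkContinuous (A.domain.subtype ∘ₗ e.symm.toLinearMap) 1 (by
    intro h
    have := LinearPMap.norm_le_norm_oneAdd hpos (e.symm h)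
    rw [he] at this
    simpa using this)
  have hR : ∀ h, R h = (e.symm h : H) := fun _ => rfl
  have hAe : ∀ h, A (e.symm h) = h - R h := fun h => by
    rw [eq_sub_iff_add_eq, hR, ← LinearPMap.oneAdd_apply, he]
  have hsymm : ∀ h k, inner ℂ (R h) k = inner ℂ h (R k) := by
    intro h k
    have h1 := LinearPMap.inner_apply_comm hA (e.symm h) (e.symm k)
    rw [hAe, hAe, ← hR, ← hR, inner_sub_left, inner_sub_right] at h1
    linear_combination -h1
  refine ⟨R, ?_, ?_, ?_, fun h => ⟨e.symm h, rfl, hAe h⟩, fun x => ⟨A.oneAdd x, ?_⟩⟩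
  · rw [ContinuousLinearMap.isPositive_def']
    refine ⟨ContinuousLinearMap.isSelfAdjoint_iff_isSymmetric.2 hsymm, fun h => ?_⟩
    have h1 := LinearPMap.norm_sq_le_re_inner_oneAdd hpos (e.symm h)
    rw [he, ← hR, ← hsymm] at h1
    exact le_trans (by positivity) h1
  · intro h
    have h1 := LinearPMap.norm_le_norm_oneAdd hpos (e.symm h)
    rw [he, ← hR] at h1
    have h2 : (inner ℂ (R h) h).re ≤ ‖R h‖ * ‖h‖ := re_inner_le_norm (𝕜 := ℂ) _ _
    nlinarith [norm_nonneg h]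
  · intro h hh
    have : e.symm h = 0 := Subtype.ext (by rw [← hR, hh]; rfl)
    simpa using this
  · rw [hR]
    exact congrArg Subtype.val (e.symm_apply_apply x)

end Resolvent

/-! ### Orthogonal projections and scalar spectral measures. -/

section StarProjection

variable {H : Type*} [NormedAddCommGroup H] [InnerProductSpace ℂ H] [CompleteSpace H]

theorem IsStarProjection.inner_apply_left {P : H →L[ℂ] H} (hP : IsStarProjection P) (f g : H) :
    inner ℂ (P f) g = inner ℂ f (P g) :=
  ContinuousLinearMap.isSelfAdjoint_iff_isSymmetric.1 hP.isSelfAdjoint f g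

theorem IsStarProjection.apply_apply {P : H →L[ℂ] H} (hP : IsStarProjection P) (f : H) :
    P (P f) = P f := by
  rw [← mul_apply_eq_comp, hP.isIdempotentElem.eq]

theorem IsStarProjection.re_inner_apply {P : H →L[ℂ] H} (hP : IsStarProjection P) (f : H) :
    (inner ℂ (P f) f).re = ‖P f‖ ^ 2 := by
  rw [← hP.apply_apply, hP.inner_apply_left, hP.apply_apply]
  exact inner_self_eq_norm_sq (𝕜 := ℂ) (P f)

theorem IsStarProjection.norm_sub_apply_sq {P : H →L[ℂ] H} (hP : IsStarProjection P) (f : H) :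
    ‖f - P f‖ ^ 2 = ‖f‖ ^ 2 - ‖P f‖ ^ 2 := by
  have h := norm_sub_sq (𝕜 := ℂ) f (P f)
  have h2 : RCLike.re (inner ℂ f (P f)) = ‖P f‖ ^ 2 := by
    rw [← hP.inner_apply_left]; exact hP.re_inner_apply f
  rw [h2] at h
  linarith

end StarProjection

namespace ResolutionOfIdentity

variable {H : Type*} [NormedAddCommGroup H] [InnerProductSpace ℂ H] [CompleteSpace H]
  (E : ResolutionOfIdentity H)

theorem apply_apply_of_le {u v : ℝ} (h : u ≤ v) (f : H) :
    E.toFun v (E.toFun u f) = E.toFun u f := by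
  refine ext_inner_right ℂ fun g => ?_
  rw [(E.isProj v).inner_apply_left, (E.isProj u).inner_apply_left, E.mono u v h,
    ← (E.isProj u).inner_apply_left]

theorem apply_apply (u v : ℝ) (f : H) :
    E.toFun u (E.toFun v f) = E.toFun (min u v) f := by
  rcases le_total u v with h | h
  · rw [E.mono u v h, min_eq_left h]
  · rw [E.apply_apply_of_le h, min_eq_right h]

theorem norm_sub_sq {u v : ℝ} (h : u ≤ v) (f : H) :
    ‖E.toFun v f - E.toFun u f‖ ^ 2 = ‖E.toFun v f‖ ^ 2 - ‖E.toFun u f‖ ^ 2 := by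
  have := (E.isProj u).norm_sub_apply_sq (E.toFun v f)
  rwa [E.mono u v h] at this

theorem norm_apply_mono {u v : ℝ} (h : u ≤ v) (f : H) : ‖E.toFun u f‖ ≤ ‖E.toFun v f‖ := by
  rw [← E.mono u v h]
  exact E.norm_apply_le _ _

theorem scalarMeasure_Ioc (f : H) (a b : ℝ) :
    E.scalarMeasure f (Set.Ioc a b) = ENNReal.ofReal (‖E.toFun b f‖ ^ 2 - ‖E.toFun a f‖ ^ 2) :=
  StieltjesFunction.measure_Ioc _ _ _

theorem stieltjes_tendsto_atTop (f : H) : Tendsto (E.stieltjes f) atTop (𝓝 (‖f‖ ^ 2)) :=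
  (E.tendsto_top f).norm.pow 2

theorem stieltjes_tendsto_atBot (f : H) : Tendsto (E.stieltjes f) atBot (𝓝 0) := by
  have := (E.tendsto_bot f).norm.pow 2
  rw [norm_zero, zero_pow two_ne_zero] at this
  exact this

theorem scalarMeasure_univ (f : H) : E.scalarMeasure f Set.univ = ENNReal.ofReal (‖f‖ ^ 2) := by
  rw [scalarMeasure, StieltjesFunction.measure_univ _ (E.stieltjes_tendsto_atBot f)
    (E.stieltjes_tendsto_atTop f), sub_zero]

theorem scalarMeasure_Iic (f : H) (a : ℝ) :
    E.scalarMeasure f (Set.Iic a) = ENNReal.ofReal (‖E.toFun a f‖ ^ 2) := by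
  rw [scalarMeasure, StieltjesFunction.measure_Iic _ (E.stieltjes_tendsto_atBot f), sub_zero]
  rfl

theorem scalarMeasure_Ioi (f : H) (a : ℝ) :
    E.scalarMeasure f (Set.Ioi a) = ENNReal.ofReal (‖f - E.toFun a f‖ ^ 2) := by
  rw [scalarMeasure, StieltjesFunction.measure_Ioi _ (E.stieltjes_tendsto_atTop f),
    (E.isProj a).norm_sub_apply_sq]
  rfl

instance (f : H) : IsFiniteMeasure (E.scalarMeasure f) :=
  ⟨by rw [scalarMeasure_univ]; exact ENNReal.ofReal_lt_top⟩

theorem scalarMeasure_apply (f : H) (c : ℝ) :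
    E.scalarMeasure (E.toFun c f) = (E.scalarMeasure f).restrict (Set.Iic c) := by
  refine Measure.ext_of_Ioc _ _ fun a b hab => ?_
  rw [Measure.restrict_apply measurableSet_Ioc, Set.Ioc_inter_Iic, scalarMeasure_Ioc,
    scalarMeasure_Ioc, E.apply_apply, E.apply_apply]
  rcases le_total a c with h | h
  · rw [min_eq_left h]
  · rw [min_eq_right h, min_eq_right (h.trans hab.le), sub_self, ENNReal.ofReal_zero, eq_comm,
      ENNReal.ofReal_eq_zero, sub_nonpos]
    gcongr
    exact E.norm_apply_mono h f

theorem scalarMeasure_apply_le (f : H) (c : ℝ) :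
    E.scalarMeasure (E.toFun c f) ≤ E.scalarMeasure f := by
  rw [scalarMeasure_apply]
  exact Measure.restrict_le_self

end ResolutionOfIdentity

/-! ### Identifying a density from bounds on small intervals. -/

section Pinched

theorem measure_Ioc_le_of_small {M N : Measure ℝ} {δ : ℝ} (hδ : 0 < δ)
    (h : ∀ a b, a < b → b - a ≤ δ → M (Set.Ioc a b) ≤ N (Set.Ioc a b)) {a b : ℝ} (hab : a < b) :
    M (Set.Ioc a b) ≤ N (Set.Ioc a b) := by
  obtain ⟨n, hn⟩ := exists_nat_ge ((b - a) / δ)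
  rw [div_le_iff₀ hδ] at hn
  induction n generalizing a with
  | zero => simp at hn; linarith
  | succ n ih =>
    by_cases hs : b - a ≤ δ
    · exact h a b hab hs
    · push Not at hs
      have hn' : b - (a + δ) ≤ n * δ := by push_cast at hn; linarith
      have h1 := h a (a + δ) (by linarith) (by linarith)
      have h2 := ih (a := a + δ) (by linarith) hn'
      have hu : Set.Ioc a b = Set.Ioc a (a + δ) ∪ Set.Ioc (a + δ) b :=
        (Set.Ioc_union_Ioc_eq_Ioc (by linarith) (by linarith)).symm
      have hd : Disjoint (Set.Ioc a (a + δ)) (Set.Ioc (a + δ) b) :=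
        Set.Ioc_disjoint_Ioc_of_le le_rfl
      rw [hu, measure_union hd measurableSet_Ioc, measure_union hd measurableSet_Ioc]
      exact add_le_add h1 h2

/-- On intervals of length at most `δ` the weight changes by at most `δ`, so after subdivision the
total error is `δ M(]a, b])`; then `δ → 0`. -/
theorem measure_Ioc_le_of_pinched {M N N' : Measure ℝ} [IsFiniteMeasure M] {w : ℝ → ℝ≥0∞}
    (hw : ∀ u v, u ≤ v → w u ≤ w v + ENNReal.ofReal (v - u))
    (hN : ∀ a b, a < b → N (Set.Ioc a b) ≤ w a * M (Set.Ioc a b))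
    (hN' : ∀ a b, a < b → w b * M (Set.Ioc a b) ≤ N' (Set.Ioc a b)) {a b : ℝ} (hab : a < b) :
    N (Set.Ioc a b) ≤ N' (Set.Ioc a b) := by
  have key : ∀ δ : ℝ, 0 < δ →
      N (Set.Ioc a b) ≤ N' (Set.Ioc a b) + ENNReal.ofReal δ * M (Set.Ioc a b) := by
    intro δ hδ
    have := measure_Ioc_le_of_small (M := N) (N := N' + ENNReal.ofReal δ • M) hδ ?_ hab
    · simpa using this
    · intro u v huv hd
      calc N (Set.Ioc u v) ≤ w u * M (Set.Ioc u v) := hN u v huv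
        _ ≤ (w v + ENNReal.ofReal δ) * M (Set.Ioc u v) := by
            gcongr
            exact (hw u v huv.le).trans (by gcongr)
        _ ≤ (N' + ENNReal.ofReal δ • M) (Set.Ioc u v) := by
            rw [add_mul]
            simp only [Measure.add_apply, Measure.smul_apply, smul_eq_mul]
            gcongr
            exact hN' u v huv
  have hlim : Tendsto (fun δ : ℝ => N' (Set.Ioc a b) + ENNReal.ofReal δ * M (Set.Ioc a b))
      (𝓝[>] 0) (𝓝 (N' (Set.Ioc a b) + ENNReal.ofReal 0 * M (Set.Ioc a b))) := by
    refine Tendsto.mono_left ?_ nhdsWithin_le_nhds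
    refine tendsto_const_nhds.add (ENNReal.Tendsto.mul_const ?_ (Or.inr (measure_ne_top M _)))
    exact (ENNReal.continuous_ofReal.tendsto 0)
  rw [ENNReal.ofReal_zero, zero_mul, add_zero] at hlim
  exact ge_of_tendsto hlim (eventually_mem_nhdsWithin.mono fun δ hδ => key δ hδ)

/-- Two measures whose ratio on every interval `]a, b]` lies between `w b` and `w a`, for a
Lipschitz antitone `w`, have `w` as density. -/
theorem eq_withDensity_of_pinched {M N : Measure ℝ} [IsFiniteMeasure M] [IsLocallyFiniteMeasure N]
    {w : ℝ → ℝ≥0∞} (hanti : Antitone w)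
    (hw : ∀ u v, u ≤ v → w u ≤ w v + ENNReal.ofReal (v - u))
    (hle : ∀ a b, a < b → N (Set.Ioc a b) ≤ w a * M (Set.Ioc a b))
    (hge : ∀ a b, a < b → w b * M (Set.Ioc a b) ≤ N (Set.Ioc a b)) :
    N = M.withDensity w := by
  refine Measure.ext_of_Ioc _ _ fun a b hab => le_antisymm ?_ ?_
  · refine measure_Ioc_le_of_pinched (M := M) hw hle (fun u v huv => ?_) hab
    rw [withDensity_apply _ measurableSet_Ioc, ← setLIntegral_const]
    exact setLIntegral_mono' measurableSet_Ioc fun x hx => hanti hx.2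
  · refine measure_Ioc_le_of_pinched (M := M) hw (fun u v huv => ?_) hge hab
    rw [withDensity_apply _ measurableSet_Ioc, ← setLIntegral_const]
    exact setLIntegral_mono' measurableSet_Ioc fun x hx => hanti hx.1.le

end Pinched

/-! ### The change of variable `u ↦ 1 / (1 + u)`, extended to the line. -/

section ResolventScale

/-- An antitone function on `ℝ` equal to `1 / (1 + u)` for `u ≥ 0` and greater than `1` for
`u < 0`. -/
def resolventScale (u : ℝ) : ℝ := (1 + max u 0)⁻¹ + max (-u) 0

theorem resolventScale_of_nonneg {u : ℝ} (hu : 0 ≤ u) : resolventScale u = (1 + u)⁻¹ := by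
  simp [resolventScale, hu]

theorem resolventScale_of_neg {u : ℝ} (hu : u < 0) : resolventScale u = 1 - u := by
  simp [resolventScale, hu.le, sub_eq_add_neg]

theorem resolventScale_pos (u : ℝ) : 0 < resolventScale u := by
  unfold resolventScale; positivity

theorem continuous_resolventScale : Continuous resolventScale := by
  unfold resolventScale
  refine Continuous.add (Continuous.inv₀ (by fun_prop) fun u => ?_) (by fun_prop)
  positivity

theorem antitone_resolventScale : Antitone resolventScale := by
  intro u v h
  unfold resolventScale
  gcongr

theorem resolventScale_le_add {u v : ℝ} (h : u ≤ v) :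
    resolventScale u ≤ resolventScale v + (v - u) := by
  have h1 : (1 + max u 0)⁻¹ ≤ (1 + max v 0)⁻¹ + (max v 0 - max u 0) := by
    have hu : 0 ≤ max u 0 := le_max_right _ _
    have hv : max u 0 ≤ max v 0 := max_le_max_right _ h
    generalize max u 0 = p at *
    generalize max v 0 = q at *
    have hp' : 1 + p ≠ 0 := by linarith
    have hq' : 1 + q ≠ 0 := by linarith
    rw [← sub_nonneg, show (1 + q)⁻¹ + (q - p) - (1 + p)⁻¹
      = (q - p) * (1 - ((1 + p) * (1 + q))⁻¹) by field_simp; ring]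
    refine mul_nonneg (by linarith) (sub_nonneg.2 (inv_le_one_of_one_le₀ ?_))
    nlinarith
  have h2 : max (-u) 0 = max u 0 - u := by
    rcases le_total u 0 with h | h <;> simp [h]
  have h3 : max (-v) 0 = max v 0 - v := by
    rcases le_total v 0 with h | h <;> simp [h]
  unfold resolventScale
  linarith

theorem tendsto_resolventScale_atTop : Tendsto resolventScale atTop (𝓝 0) := by
  have h : Tendsto (fun u : ℝ => (1 + u)⁻¹) atTop (𝓝 0) :=
    tendsto_inv_atTop_zero.comp (tendsto_atTop_add_const_left _ _ tendsto_id)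
  refine h.congr' ?_
  filter_upwards [eventually_ge_atTop 0] with u hu
  rw [resolventScale_of_nonneg hu]

end ResolventScale

/-! ### The spectral family built from the resolvent. -/

section ResolventFamily

variable {H : Type*} [NormedAddCommGroup H] [InnerProductSpace ℂ H] [CompleteSpace H]

/-- As `v` decreases to `u` the orthogonal complements increase, so the convergence theorem for
increasing subspaces applies to them; the order dual of `]u, ∞[` makes the family monotone. -/
theorem starProjection_tendsto_of_antitone {u : ℝ} {U : ℝ → Submodule ℂ H}
    [∀ v, CompleteSpace (U v)] (hU : Monotone U) (hinf : ∀ k, (∀ v > u, k ∈ U v) → k ∈ U u)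
    (f : H) :
    Tendsto (fun v => (U v).starProjection f) (𝓝[>] u) (𝓝 ((U u).starProjection f)) := by
  let V : (Set.Ioi u)ᵒᵈ → Submodule ℂ H := fun v => (U (OrderDual.ofDual v : Set.Ioi u))ᗮ
  have hV : Monotone V := fun a b hab => Submodule.orthogonal_le (hU hab)
  have hcl : (⨆ v, V v).topologicalClosure = (U u)ᗮ := by
    rw [← Submodule.orthogonal_orthogonal_eq_closure, ← Submodule.iInf_orthogonal]
    congr 1
    refine le_antisymm (fun k hk => hinf k fun v hv => ?_) (le_iInf fun v => ?_)
    · have := (Submodule.mem_iInf _).1 hk (OrderDual.toDual ⟨v, hv⟩)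
      rwa [show (V (OrderDual.toDual ⟨v, hv⟩))ᗮ = U v from
        Submodule.orthogonal_orthogonal (U v)] at this
    · rw [show (V v)ᗮ = U (OrderDual.ofDual v : Set.Ioi u) from
        Submodule.orthogonal_orthogonal (U _)]
      exact hU (le_of_lt (OrderDual.ofDual v).2)
  have h := Submodule.starProjection_tendsto_closure_iSup V hV f
  simp only [hcl] at h
  have h2 := (tendsto_const_nhds (x := f)).sub h
  simp only [V, Submodule.starProjection_orthogonal_val, sub_sub_cancel] at h2
  rw [← map_coe_Ioi_atBot u, tendsto_map'_iff]
  exact h2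

theorem mem_upperSpace_resolventScale {R : H →L[ℂ] H} {u : ℝ} {k : H}
    (h : ∀ v > u, k ∈ upperSpace R (resolventScale v)) : k ∈ upperSpace R (resolventScale u) := by
  refine mem_upperSpace_of_forall_lt (T := resolventScale '' Set.Ioi u) ?_ ?_
  · refine mem_closure_of_tendsto (b := 𝓝[>] u) (f := resolventScale)
      (continuous_resolventScale.tendsto u |>.mono_left nhdsWithin_le_nhds) ?_
    filter_upwards [self_mem_nhdsWithin] with v hv using ⟨v, hv, rfl⟩
  · rintro _ ⟨v, hv, rfl⟩
    exact h v hv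

/-- This is why `resolventScale` exceeds `1` on negative numbers: the projections vanish there. -/
theorem upperSpace_eq_bot {R : H →L[ℂ] H} (hR : IsSelfAdjoint R)
    (h1 : ∀ h, (inner ℂ (R h) h).re ≤ ‖h‖ ^ 2) {t : ℝ} (ht : 1 < t) : upperSpace R t = ⊥ := by
  rw [Submodule.eq_bot_iff]
  intro k hk
  have := le_re_inner_of_mem_upperSpace hR hk
  by_contra hne
  have hpos : 0 < ‖k‖ ^ 2 := by positivity
  nlinarith [h1 k]

/-- A vector orthogonal to every `upperSpace` has `⟨R k, k⟩ ≤ resolventScale u * ‖k‖² → 0`. Hence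
`√R k = 0`, so `R k = 0`, and injectivity applies. -/
theorem topologicalClosure_iSup_upperSpace {R : H →L[ℂ] H} (hR : R.IsPositive)
    (hinj : ∀ h, R h = 0 → h = 0) :
    (⨆ u, upperSpace R (resolventScale u)).topologicalClosure = ⊤ := by
  rw [Submodule.topologicalClosure_eq_top_iff, ← Submodule.iInf_orthogonal, Submodule.eq_bot_iff]
  intro k hk
  rw [Submodule.mem_iInf] at hk
  have h1 : (inner ℂ (R k) k).re ≤ 0 := by
    have hlim := tendsto_resolventScale_atTop.mul_const (‖k‖ ^ 2)
    rw [zero_mul] at hlim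
    exact ge_of_tendsto' hlim fun u =>
      re_inner_le_of_mem_orthogonal_upperSpace hR.isSelfAdjoint (hk u)
  obtain ⟨S, hS, -, rfl⟩ := exists_sqrt hR
  have hsymm := ContinuousLinearMap.isSelfAdjoint_iff_isSymmetric.1 hS
  have h2 : (inner ℂ ((S * S) k) k).re = ‖S k‖ ^ 2 := by
    rw [mul_apply_eq_comp, show inner ℂ (S (S k)) k = inner ℂ (S k) (S k) from hsymm _ _]
    exact inner_self_eq_norm_sq (𝕜 := ℂ) (S k)
  rw [h2] at h1
  have h3 : S k = 0 := norm_eq_zero.1 (pow_eq_zero_iff two_ne_zero |>.1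
    (le_antisymm h1 (by positivity)))
  exact hinj k (by rw [mul_apply_eq_comp, h3, map_zero])

/-- The spectral family of `R⁻¹ - 1`, for an injective `0 ≤ R ≤ 1`. -/
def resolventFamily (R : H →L[ℂ] H) (hR : R.IsPositive)
    (h1 : ∀ h, (inner ℂ (R h) h).re ≤ ‖h‖ ^ 2) (hinj : ∀ h, R h = 0 → h = 0) :
    ResolutionOfIdentity H where
  toFun u := (upperSpace R (resolventScale u)).starProjection
  isProj _ := isStarProjection_starProjection
  mono u v huv f := by
    rw [← ContinuousLinearMap.comp_apply, Submodule.starProjection_comp_starProjection_of_le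
      (upperSpace_anti R (antitone_resolventScale huv))]
  rightCont u f := starProjection_tendsto_of_antitone
    (U := fun v => upperSpace R (resolventScale v))
    (fun _ _ h => upperSpace_anti R (antitone_resolventScale h))
    (fun _ => mem_upperSpace_resolventScale) f
  tendsto_bot f := by
    apply tendsto_const_nhds.congr'
    filter_upwards [eventually_lt_atBot (0 : ℝ)] with v hv
    have hb := upperSpace_eq_bot hR.isSelfAdjoint h1 (t := resolventScale v)
      (by rw [resolventScale_of_neg hv]; linarith)
    rw [eq_comm, Submodule.starProjection_apply_eq_zero_iff, hb, Submodule.bot_orthogonal_eq_top]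
    trivial
  tendsto_top f := Submodule.starProjection_tendsto_self _
    (fun _ _ h => upperSpace_anti R (antitone_resolventScale h)) f
    (topologicalClosure_iSup_upperSpace hR hinj).ge

variable {R : H →L[ℂ] H} (hR : R.IsPositive)
    (h1 : ∀ h, (inner ℂ (R h) h).re ≤ ‖h‖ ^ 2) (hinj : ∀ h, R h = 0 → h = 0)

theorem resolventFamily_of_neg {u : ℝ} (hu : u < 0) (f : H) :
    (resolventFamily R hR h1 hinj).toFun u f = 0 := by
  have hb := upperSpace_eq_bot hR.isSelfAdjoint h1 (t := resolventScale u)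
    (by rw [resolventScale_of_neg hu]; linarith)
  change (upperSpace R (resolventScale u)).starProjection f = 0
  rw [Submodule.starProjection_apply_eq_zero_iff, hb, Submodule.bot_orthogonal_eq_top]
  trivial

theorem resolventFamily_ae_nonneg (f : H) :
    ∀ᵐ u ∂(resolventFamily R hR h1 hinj).scalarMeasure f, 0 ≤ u := by
  set E := resolventFamily R hR h1 hinj
  have h : (E.scalarMeasure f) (Set.Iio 0) = 0 := by
    rw [ResolutionOfIdentity.scalarMeasure,
      StieltjesFunction.measure_Iio _ (E.stieltjes_tendsto_atBot f)]
    rw [leftLim_eq_of_tendsto (y := 0), sub_zero, ENNReal.ofReal_zero]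
    apply tendsto_const_nhds.congr'
    filter_upwards [self_mem_nhdsWithin] with v hv
    change 0 = ‖E.toFun v f‖ ^ 2
    simp [E, resolventFamily_of_neg hR h1 hinj hv]
  rw [ae_iff]
  simp only [not_le]
  exact h

theorem resolventFamily_comm {S : H →L[ℂ] H} (hS : IsSelfAdjoint S) (hc : Commute R S) (u : ℝ)
    (f : H) : (resolventFamily R hR h1 hinj).toFun u (S f) =
      S ((resolventFamily R hR h1 hinj).toFun u f) :=
  starProjection_upperSpace_comm hR.isSelfAdjoint hS hc _ _

theorem resolventFamily_exists_preimage (u : ℝ) (f : H) :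
    ∃ h, R h = (resolventFamily R hR h1 hinj).toFun u f :=
  exists_apply_eq_of_mem_upperSpace hR.isSelfAdjoint (resolventScale_pos u)
    (Submodule.starProjection_apply_mem _ f)

/-- The measure of `√R f` has density `1 / (1 + u)` with respect to that of `f`. -/
theorem resolventFamily_scalarMeasure_sqrt {S : H →L[ℂ] H} (hS : IsSelfAdjoint S)
    (hc : Commute R S) (hSS : S * S = R) (f : H) :
    (resolventFamily R hR h1 hinj).scalarMeasure (S f) =
      ((resolventFamily R hR h1 hinj).scalarMeasure f).withDensity
        fun u => ENNReal.ofReal (resolventScale u) := by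
  set E := resolventFamily R hR h1 hinj with hE
  have hsymm := ContinuousLinearMap.isSelfAdjoint_iff_isSymmetric.1 hS
  have hnorm : ∀ k, (inner ℂ (R k) k).re = ‖S k‖ ^ 2 := fun k => by
    rw [← hSS, mul_apply_eq_comp, show inner ℂ (S (S k)) k = inner ℂ (S k) (S k) from hsymm _ _]
    exact inner_self_eq_norm_sq (𝕜 := ℂ) (S k)
  have hIoc : ∀ a b, a < b → (E.scalarMeasure (S f)) (Set.Ioc a b) =
      ENNReal.ofReal (inner ℂ (R (E.toFun b f - E.toFun a f)) (E.toFun b f - E.toFun a f)).re := by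
    intro a b hab
    rw [E.scalarMeasure_Ioc, ← E.norm_sub_sq hab.le, resolventFamily_comm _ _ _ hS hc,
      resolventFamily_comm _ _ _ hS hc, ← map_sub, hnorm]
  have hIoc' : ∀ a b, a < b → (E.scalarMeasure f) (Set.Ioc a b) =
      ENNReal.ofReal (‖E.toFun b f - E.toFun a f‖ ^ 2) := by
    intro a b hab
    rw [E.scalarMeasure_Ioc, ← E.norm_sub_sq hab.le]
  -- The increment `E_b f - E_a f` is killed by `E_a` and fixed by `E_b`, so the form of `R` on it
  -- lies between `resolventScale b` and `resolventScale a` times its squared norm.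
  refine eq_withDensity_of_pinched
    (fun u v h => ENNReal.ofReal_le_ofReal (antitone_resolventScale h)) ?_ ?_ ?_
  · intro u v h
    rw [← ENNReal.ofReal_add (resolventScale_pos _).le (sub_nonneg.2 h)]
    exact ENNReal.ofReal_le_ofReal (resolventScale_le_add h)
  · intro a b hab
    rw [hIoc a b hab, hIoc' a b hab, ← ENNReal.ofReal_mul (resolventScale_pos _).le]
    refine ENNReal.ofReal_le_ofReal
      (re_inner_le_of_mem_orthogonal_upperSpace hR.isSelfAdjoint ?_)
    rw [← Submodule.starProjection_apply_eq_zero_iff]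
    change E.toFun a (E.toFun b f - E.toFun a f) = 0
    rw [map_sub, E.mono a b hab.le, E.mono a a le_rfl, sub_self]
  · intro a b hab
    rw [hIoc a b hab, hIoc' a b hab, ← ENNReal.ofReal_mul (resolventScale_pos _).le]
    refine ENNReal.ofReal_le_ofReal (le_re_inner_of_mem_upperSpace hR.isSelfAdjoint ?_)
    rw [← Submodule.starProjection_eq_self_iff]
    change E.toFun b (E.toFun b f - E.toFun a f) = E.toFun b f - E.toFun a f
    rw [map_sub, E.mono b b le_rfl, E.apply_apply_of_le hab.le]

theorem resolventFamily_scalarMeasure_apply (f : H) :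
    (resolventFamily R hR h1 hinj).scalarMeasure (R f) =
      ((resolventFamily R hR h1 hinj).scalarMeasure f).withDensity
        fun u => ENNReal.ofReal (resolventScale u ^ 2) := by
  obtain ⟨S, hS, hc, hSS⟩ := exists_sqrt hR
  have hm : Measurable fun u => ENNReal.ofReal (resolventScale u) :=
    continuous_resolventScale.measurable.ennreal_ofReal
  have hRS : R f = S (S f) := by rw [← mul_apply_eq_comp, hSS]
  rw [hRS,
    resolventFamily_scalarMeasure_sqrt hR h1 hinj hS hc hSS,
    resolventFamily_scalarMeasure_sqrt hR h1 hinj hS hc hSS, ← withDensity_mul _ hm hm]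
  congr 1
  ext u
  rw [Pi.mul_apply, sq, ENNReal.ofReal_mul (resolventScale_pos u).le]

end ResolventFamily

/-! ### The spectral theorem for nonnegative self-adjoint operators. -/

section SpectralTheorem

variable {H : Type*} [NormedAddCommGroup H] [InnerProductSpace ℂ H] [CompleteSpace H]

theorem ResolutionOfIdentity.norm_sq_eq_toReal_univ (E : ResolutionOfIdentity H) (f : H) :
    ‖f‖ ^ 2 = (E.scalarMeasure f Set.univ).toReal := by
  rw [E.scalarMeasure_univ, ENNReal.toReal_ofReal (by positivity)]

section

variable {R : H →L[ℂ] H} (hR : R.IsPositive)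
    (h1 : ∀ h, (inner ℂ (R h) h).re ≤ ‖h‖ ^ 2) (hinj : ∀ h, R h = 0 → h = 0)

theorem resolventFamily_lintegral_sq_lt_top (h : H) :
    ∫⁻ u, ENNReal.ofReal (u ^ 2) ∂((resolventFamily R hR h1 hinj).scalarMeasure (R h)) < ∞ := by
  rw [resolventFamily_scalarMeasure_apply, lintegral_withDensity_eq_lintegral_mul _
    (continuous_resolventScale.measurable.pow_const 2).ennreal_ofReal (by fun_prop)]
  refine lt_of_le_of_lt (lintegral_mono_ae (g := fun _ => 1) ?_) ?_
  · filter_upwards [resolventFamily_ae_nonneg hR h1 hinj h] with u hu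
    rw [Pi.mul_apply, ← ENNReal.ofReal_mul (by positivity), ← mul_pow, ENNReal.ofReal_le_one,
      resolventScale_of_nonneg hu]
    refine pow_le_one₀ (by positivity) ?_
    rw [inv_mul_le_iff₀ (by positivity)]
    linarith
  · rw [lintegral_one]
    exact measure_lt_top _ _

/-- The identity behind it is `u / (1+u)² = 1 / (1+u) - 1 / (1+u)²`, integrated against the measure
of `h`. -/
theorem resolventFamily_integral_id (h : H) :
    ∫ u, u ∂((resolventFamily R hR h1 hinj).scalarMeasure (R h)) =
      (inner ℂ (R h) h).re - ‖R h‖ ^ 2 := by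
  set E := resolventFamily R hR h1 hinj
  obtain ⟨S, hS, hc, hSS⟩ := exists_sqrt hR
  have hsymm := ContinuousLinearMap.isSelfAdjoint_iff_isSymmetric.1 hS
  have hm := continuous_resolventScale.measurable
  have hnn := resolventFamily_ae_nonneg hR h1 hinj h
  have hb : ∀ᵐ u ∂E.scalarMeasure h, ‖resolventScale u‖ ≤ 1 := by
    filter_upwards [hnn] with u hu
    rw [Real.norm_of_nonneg (resolventScale_pos u).le, resolventScale_of_nonneg hu]
    exact inv_le_one_of_one_le₀ (by linarith)
  have hi1 : Integrable resolventScale (E.scalarMeasure h) :=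
    Integrable.of_bound hm.aestronglyMeasurable 1 hb
  have hi2 : Integrable (fun u => resolventScale u ^ 2) (E.scalarMeasure h) := by
    refine Integrable.of_bound (hm.pow_const 2).aestronglyMeasurable 1 ?_
    filter_upwards [hb] with u hu
    rw [norm_pow]
    exact pow_le_one₀ (norm_nonneg _) hu
  have e1 : (inner ℂ (R h) h).re = ∫ u, resolventScale u ∂(E.scalarMeasure h) := by
    have : (inner ℂ (R h) h).re = ‖S h‖ ^ 2 := by
      rw [← hSS, mul_apply_eq_comp, show inner ℂ (S (S h)) h = inner ℂ (S h) (S h) from hsymm _ _]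
      exact inner_self_eq_norm_sq (𝕜 := ℂ) (S h)
    rw [this, E.norm_sq_eq_toReal_univ, resolventFamily_scalarMeasure_sqrt hR h1 hinj hS hc hSS,
      withDensity_apply _ MeasurableSet.univ, Measure.restrict_univ,
      integral_eq_lintegral_of_nonneg_ae (Eventually.of_forall fun u => (resolventScale_pos u).le)
        hm.aestronglyMeasurable]
  have e2 : ‖R h‖ ^ 2 = ∫ u, resolventScale u ^ 2 ∂(E.scalarMeasure h) := by
    rw [E.norm_sq_eq_toReal_univ, resolventFamily_scalarMeasure_apply,
      withDensity_apply _ MeasurableSet.univ, Measure.restrict_univ,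
      integral_eq_lintegral_of_nonneg_ae (Eventually.of_forall fun u => sq_nonneg _)
        (hm.pow_const 2).aestronglyMeasurable]
  rw [e1, e2, ← integral_sub hi1 hi2, resolventFamily_scalarMeasure_apply,
    integral_withDensity_eq_integral_toReal_smul₀ (hm.pow_const 2).ennreal_ofReal.aemeasurable
      (Eventually.of_forall fun _ => ENNReal.ofReal_lt_top)]
  refine integral_congr_ae ?_
  filter_upwards [hnn] with u hu
  have : 1 + u ≠ 0 := by positivity
  rw [ENNReal.toReal_ofReal (by positivity), resolventScale_of_nonneg hu, smul_eq_mul]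
  field_simp
  ring

/-- Formally `h = (1 + A) E_v f`, so `‖h‖² ≤ ∫ (1+u)² d⟨E_u f, f⟩`, and `(1+u)² ≤ 2 + 2u²`.
Uniformity in `v` is what puts `f` in the domain of `A`. -/
theorem resolventFamily_norm_preimage_le {f : H}
    (hf : ∫⁻ u, ENNReal.ofReal (u ^ 2) ∂((resolventFamily R hR h1 hinj).scalarMeasure f) < ∞) :
    ∃ C, ∀ v h, R h = (resolventFamily R hR h1 hinj).toFun v f → ‖h‖ ≤ C := by
  set E := resolventFamily R hR h1 hinj
  set I : ℝ≥0∞ := ∫⁻ u, (2 + 2 * ENNReal.ofReal (u ^ 2)) ∂(E.scalarMeasure f) with hI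
  have hIfin : I ≠ ∞ := by
    rw [hI, lintegral_add_left measurable_const, lintegral_const,
      lintegral_const_mul _ (by fun_prop)]
    exact ENNReal.add_ne_top.2 ⟨ENNReal.mul_ne_top (by simp) (measure_ne_top _ _),
      ENNReal.mul_ne_top (by simp) hf.ne⟩
  refine ⟨√I.toReal, fun v h hh => Real.le_sqrt_of_sq_le ?_⟩
  rw [E.norm_sq_eq_toReal_univ]
  refine ENNReal.toReal_mono hIfin ?_
  calc E.scalarMeasure h Set.univ = ∫⁻ _, 1 ∂(E.scalarMeasure h) := by simp
    _ ≤ ∫⁻ u, ENNReal.ofReal (resolventScale u ^ 2) * (2 + 2 * ENNReal.ofReal (u ^ 2))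
          ∂(E.scalarMeasure h) := by
        refine lintegral_mono_ae ?_
        filter_upwards [resolventFamily_ae_nonneg hR h1 hinj h] with u hu
        rw [show (2 : ℝ≥0∞) = ENNReal.ofReal 2 by simp, ← ENNReal.ofReal_mul (by norm_num),
          ← ENNReal.ofReal_add (by norm_num) (by positivity), ← ENNReal.ofReal_mul (by positivity),
          ENNReal.one_le_ofReal, resolventScale_of_nonneg hu, inv_pow,
          le_inv_mul_iff₀ (by positivity)]
        nlinarith [sq_nonneg (1 - u)]
    _ = ∫⁻ u, (2 + 2 * ENNReal.ofReal (u ^ 2)) ∂(E.scalarMeasure (E.toFun v f)) := by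
        rw [← hh, resolventFamily_scalarMeasure_apply, lintegral_withDensity_eq_lintegral_mul _
          (continuous_resolventScale.measurable.pow_const 2).ennreal_ofReal (by fun_prop)]
        rfl
    _ ≤ I := lintegral_mono' (E.scalarMeasure_apply_le f v) le_rfl

end

/-- The spectral theorem for nonnegative self-adjoint operators. -/
theorem exists_represents {A : H →ₗ.[ℂ] H} (hA : IsSelfAdjoint A) (hpos : OpNonneg A) :
    ∃ E : ResolutionOfIdentity H, E.Represents A := by
  obtain ⟨R, hR, h1, hinj, hdom, hran⟩ := LinearPMap.exists_resolvent hA hpos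
  have hsymm := hR.isSymmetric
  refine ⟨resolventFamily R hR h1 hinj, fun f => ⟨fun hf => ?_, fun hf => ?_⟩, fun f => ?_⟩
  · obtain ⟨h, hh⟩ := hran ⟨f, hf⟩
    rw [show f = R h from hh.symm]
    exact resolventFamily_lintegral_sq_lt_top hR h1 hinj h
  · set E := resolventFamily R hR h1 hinj
    obtain ⟨C, hC⟩ := resolventFamily_norm_preimage_le hR h1 hinj hf
    -- Each `E_v f` lies in the domain and `‖A E_v f‖ ≤ C + ‖f‖`. Symmetry and `v → ∞` bound `x ↦
    -- ⟨f, A x⟩`, so `f` is in the domain of the adjoint.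
    have hbound : ∀ x : A.domain, ‖inner ℂ f (A x)‖ ≤ (C + ‖f‖) * ‖(x : H)‖ := by
      intro x
      have hlim : Tendsto (fun v => ‖inner ℂ (E.toFun v f) (A x)‖) atTop
          (𝓝 ‖inner ℂ f (A x)‖) := ((E.tendsto_top f).inner tendsto_const_nhds).norm
      refine le_of_tendsto' hlim fun v => ?_
      obtain ⟨h, hh⟩ := resolventFamily_exists_preimage hR h1 hinj v f
      obtain ⟨y, hy, hAy⟩ := hdom h
      have hAy' : ‖A y‖ ≤ C + ‖f‖ := by
        rw [hAy, hh]
        exact (norm_sub_le _ _).trans (add_le_add (hC v h hh) (E.norm_apply_le v f))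
      rw [show E.toFun v f = (y : H) by rw [hy, hh], ← LinearPMap.inner_apply_comm hA]
      exact (norm_inner_le_norm _ _).trans (by gcongr)
    have hmem : f ∈ A.adjoint.domain := by
      rw [LinearPMap.mem_adjoint_domain_iff]
      exact AddMonoidHomClass.continuous_of_bound ((innerₛₗ ℂ f).comp A.toFun) (C + ‖f‖) hbound
    rwa [LinearPMap.isSelfAdjoint_def.1 hA] at hmem
  · obtain ⟨h, hh⟩ := hran f
    obtain ⟨x, hx, hAx⟩ := hdom h
    obtain rfl : x = f := Subtype.ext (hx.trans hh)
    rw [hAx, hx, resolventFamily_integral_id, inner_sub_left]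
    have e1 : inner ℂ h (R h) = inner ℂ (R h) h := (hsymm h h).symm
    have e2 : (inner ℂ (R h) h : ℂ) = ((inner ℂ (R h) h).re : ℂ) :=
      (hsymm.coe_re_inner_apply_self h).symm
    have e3 : (inner ℂ (R h) (R h) : ℂ) = ((‖R h‖ ^ 2 : ℝ) : ℂ) := by
      rw [inner_self_eq_norm_sq_to_K]; push_cast; rfl
    rw [e1, e2, e3, Complex.ofReal_sub, Complex.ofReal_re]

theorem spectralFamily_represents {A : H →ₗ.[ℂ] H} (hA : IsSelfAdjoint A) (hpos : OpNonneg A) :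
    (spectralFamily A).Represents A := by
  have h := exists_represents hA hpos
  rw [spectralFamily, dif_pos h]
  exact h.choose_spec

end SpectralTheorem

/-! ### The spectral projection at zero and the kernel. -/

section Kernel

variable {H : Type*} [NormedAddCommGroup H] [InnerProductSpace ℂ H] [CompleteSpace H]

/-- Vectors with zero energy are in the kernel. -/
theorem apply_eq_zero_of_re_inner_nonpos {A : H →ₗ.[ℂ] H} (hA : IsSelfAdjoint A)
    (hpos : OpNonneg A) {g : A.domain} (hg : (inner ℂ (A g) (g : H)).re ≤ 0) : A g = 0 := by
  have hre : ∀ h : A.domain, (inner ℂ (A g) (h : H)).re = 0 := by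
    intro h
    have key : ∀ t : ℝ, 0 ≤ 2 * (inner ℂ (A g) (h : H)).re * t
        + (inner ℂ (A h) (h : H)).re * (t * t) := by
      intro t
      have h1 := hpos (g + (t : ℂ) • h)
      have h2 : inner ℂ (A h) (g : H) = (starRingEnd ℂ) (inner ℂ (A g) (h : H)) := by
        rw [LinearPMap.inner_apply_comm hA, inner_conj_symm]
      rw [LinearPMap.map_add, LinearPMap.map_smul, Submodule.coe_add, Submodule.coe_smul,
        inner_add_left, inner_add_right, inner_add_right, inner_smul_left, inner_smul_right, inner_smul_left, inner_smul_right,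
        h2] at h1
      simp only [Complex.add_re, Complex.conj_ofReal, Complex.re_ofReal_mul, Complex.conj_re] at h1
      nlinarith
    by_contra hne
    set b := (inner ℂ (A g) (h : H)).re with hb
    set c := (inner ℂ (A h) (h : H)).re with hc
    have hc0 : 0 ≤ c := hpos h
    -- A near-minimiser of the quadratic; the `+ 1` keeps the denominator positive when `c = 0`.
    have := key (-b / (c + 1))
    have hb2 : 0 < b ^ 2 := by positivity
    have e : 2 * b * (-b / (c + 1)) + c * (-b / (c + 1) * (-b / (c + 1)))
        = - (b ^ 2 * (c + 2) / (c + 1) ^ 2) := by field_simp; ring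
    rw [e] at this
    have : 0 < b ^ 2 * (c + 2) / (c + 1) ^ 2 := by positivity
    linarith
  refine hA.dense_domain.eq_zero_of_inner_left ℂ fun h hh => ?_
  lift h to A.domain using hh
  refine Complex.ext (hre h) ?_
  have := hre (Complex.I • h)
  rw [Submodule.coe_smul, inner_smul_right, Complex.I_mul_re] at this
  simpa using this

/-- For `v < 0` the vector `g = E_0 f - E_v f` has spectral measure carried by `]v, 0]`, so it lies
in the domain with `⟨A g, g⟩ ≤ 0`, hence in the kernel. Then `‖g‖² = ⟨g, f⟩ = 0`, and `v → -∞`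
concludes. -/
theorem spectralFamily_zero_apply_of_mem_orthogonal_ker {A : H →ₗ.[ℂ] H} (hA : IsSelfAdjoint A)
    (hpos : OpNonneg A) {f : H} (hf : f ∈ (opKer A)ᗮ) : (spectralFamily A).toFun 0 f = 0 := by
  have hrep := spectralFamily_represents hA hpos
  set E := spectralFamily A
  have hzero : ∀ v < 0, E.toFun 0 f - E.toFun v f = 0 := by
    intro v hv
    set g := E.toFun 0 f - E.toFun v f with hg
    have h0 : E.toFun 0 g = g := by
      rw [hg, map_sub, E.mono 0 0 le_rfl, E.apply_apply_of_le hv.le]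
    have hv0 : E.toFun v g = 0 := by
      rw [hg, map_sub, E.mono v 0 hv.le, E.mono v v le_rfl, sub_self]
    have hle : ∀ᵐ u ∂E.scalarMeasure g, u ≤ 0 := by
      rw [ae_iff]
      simp only [not_le]
      change E.scalarMeasure g (Set.Ioi 0) = 0
      rw [E.scalarMeasure_Ioi, h0, sub_self]; simp
    have hge : ∀ᵐ u ∂E.scalarMeasure g, v < u := by
      rw [ae_iff]
      simp only [not_lt]
      change E.scalarMeasure g (Set.Iic v) = 0
      rw [E.scalarMeasure_Iic, hv0]; simp
    have hmem : g ∈ A.domain := by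
      rw [hrep.1 g]
      refine lt_of_le_of_lt (lintegral_mono_ae (g := fun _ => ENNReal.ofReal (v ^ 2)) ?_) ?_
      · filter_upwards [hle, hge] with u hu hu'
        exact ENNReal.ofReal_le_ofReal (by nlinarith)
      · rw [lintegral_const]
        exact ENNReal.mul_lt_top ENNReal.ofReal_lt_top (measure_lt_top _ _)
    have hA0 : A ⟨g, hmem⟩ = 0 := by
      refine apply_eq_zero_of_re_inner_nonpos hA hpos ?_
      rw [hrep.2 ⟨g, hmem⟩, Complex.ofReal_re]
      exact integral_nonpos_of_ae hle
    have hker : g ∈ opKer A := ⟨⟨g, hmem⟩, hA0, rfl⟩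
    have hin : inner ℂ g f = 0 := Submodule.inner_right_of_mem_orthogonal hker hf
    have hself : inner ℂ g g = inner ℂ g f := by
      conv_lhs => rw [hg]
      rw [inner_sub_right, ← (E.isProj 0).inner_apply_left, ← (E.isProj v).inner_apply_left,
        h0, hv0, inner_zero_left, sub_zero]
    rw [hin] at hself
    exact inner_self_eq_zero.1 hself
  refine tendsto_nhds_unique (tendsto_const_nhds.congr' ?_) (E.tendsto_bot f)
  filter_upwards [eventually_lt_atBot (0 : ℝ)] with v hv
  exact sub_eq_zero.1 (hzero v hv)

end Kernel

/-! ### Ultracontractive norms of projections. -/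

section Ultracontractive

variable {X : Type*} [MeasurableSpace X] {μ : Measure X}

theorem eLpNorm_two_sq (f : X → ℂ) : eLpNorm f 2 μ ^ 2 = ∫⁻ x, ‖f x‖ₑ ^ 2 ∂μ := by
  have h := eLpNorm_nnreal_pow_eq_lintegral (f := f) (μ := μ) (p := 2) two_ne_zero
  simpa using h

theorem Lp_eLpNorm_eq_ofReal (f : Lp ℂ 2 μ) : eLpNorm f 2 μ = ENNReal.ofReal ‖f‖ := by
  rw [Lp.norm_def, ENNReal.ofReal_toReal (Lp.eLpNorm_ne_top f)]

theorem Lp_eLpNorm_sq_eq_ofReal (f : Lp ℂ 2 μ) :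
    eLpNorm f 2 μ ^ 2 = ENNReal.ofReal (‖f‖ ^ 2) := by
  rw [Lp_eLpNorm_eq_ofReal, ENNReal.ofReal_pow (norm_nonneg _)]

theorem Lp_eLpNorm_ne_zero {f : Lp ℂ 2 μ} (hf : f ≠ 0) (p : ℝ≥0∞) (hp : p ≠ 0) :
    eLpNorm f p μ ≠ 0 := by
  rw [Ne, eLpNorm_eq_zero_iff (Lp.aestronglyMeasurable f) hp]
  exact fun h => hf ((Lp.eq_zero_iff_ae_eq_zero).2 h)

/-- Duality: a function in `L²` whose pairing with `L¹ ∩ L²` is bounded by `C ‖h‖₁` is bounded by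
`C`. -/
theorem eLpNorm_top_le_of_inner_le {φ : Lp ℂ 2 μ} {C : ℝ≥0∞}
    (h : ∀ g : Lp ℂ 2 μ, eLpNorm g 1 μ ≠ ∞ → ‖inner ℂ φ g‖ₑ ≤ C * eLpNorm g 1 μ) :
    eLpNorm φ ∞ μ ≤ C := by
  refine le_of_forall_gt_imp_ge_of_dense fun C' hC' => ?_
  rcases eq_or_ne C' ∞ with rfl | hCtop
  · exact le_top
  have hC0 : C' ≠ 0 := (bot_le.trans_lt hC').ne'
  have hφm : Measurable φ := (Lp.stronglyMeasurable φ).measurable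
  -- Testing against `g = φ 1_B` gives `C' ‖g‖₁ ≤ ‖g‖₂² = ⟨φ, g⟩ ≤ C ‖g‖₁` with `C < C'`, so `g =
  -- 0`. The first inequality also shows `g ∈ L¹`.
  let B : Set X := {x | C' ≤ ‖φ x‖ₑ}
  have hB : MeasurableSet B := measurableSet_le measurable_const hφm.enorm
  have hmem : MemLp (B.indicator φ) 2 μ := (Lp.memLp φ).indicator hB
  let g : Lp ℂ 2 μ := hmem.toLp _
  have hg : g =ᵐ[μ] B.indicator φ := hmem.coeFn_toLp
  have hg1 : eLpNorm g 1 μ = ∫⁻ x in B, ‖φ x‖ₑ ∂μ := by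
    rw [eLpNorm_congr_ae hg, eLpNorm_one_eq_lintegral_enorm, ← lintegral_indicator hB]
    congr 1 with x
    by_cases hx : x ∈ B <;> simp [hx]
  have hg2 : eLpNorm g 2 μ ^ 2 = ∫⁻ x in B, ‖φ x‖ₑ ^ 2 ∂μ := by
    rw [eLpNorm_congr_ae hg, eLpNorm_two_sq, ← lintegral_indicator hB]
    congr 1 with x
    by_cases hx : x ∈ B <;> simp [hx]
  have hlow : C' * eLpNorm g 1 μ ≤ eLpNorm g 2 μ ^ 2 := by
    rw [hg1, hg2, ← lintegral_const_mul _ hφm.enorm]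
    refine setLIntegral_mono' hB fun x hx => ?_
    rw [sq]
    gcongr
    exact hx
  have hfin : eLpNorm g 1 μ ≠ ∞ := by
    intro htop
    rw [htop, ENNReal.mul_top hC0] at hlow
    exact ENNReal.pow_ne_top (Lp.eLpNorm_ne_top g) (top_le_iff.1 hlow)
  have hinner : inner ℂ φ g = inner ℂ g g := by
    rw [L2.inner_def, L2.inner_def]
    refine integral_congr_ae ?_
    filter_upwards [hg] with x hx
    rw [hx]
    by_cases hxB : x ∈ B <;> simp [hxB]
  have hup := h g hfin
  have hnorm : ‖inner ℂ φ g‖ₑ = eLpNorm g 2 μ ^ 2 := by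
    rw [hinner, Lp_eLpNorm_sq_eq_ofReal, inner_self_eq_norm_sq_to_K, ← ofReal_norm]
    simp
  rw [hnorm] at hup
  have hg0 : eLpNorm g 1 μ = 0 := by
    by_contra hne
    exact absurd (hlow.trans hup) (not_le.2 (ENNReal.mul_lt_mul_left hne hfin hC'))
  have hBnull : ∀ᵐ x ∂μ, x ∉ B := by
    rw [eLpNorm_eq_zero_iff (Lp.aestronglyMeasurable g) one_ne_zero] at hg0
    filter_upwards [hg, hg0] with x hx hx0 hxB
    rw [hx0, Set.indicator_of_mem hxB] at hx
    have : C' ≤ ‖φ x‖ₑ := hxB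
    rw [← hx] at this
    simp at this
    exact hC0 this
  rw [eLpNorm_exponent_top]
  refine eLpNormEssSup_le_of_ae_enorm_bound ?_
  filter_upwards [hBnull] with x hx
  exact (not_le.1 hx).le

theorem eLpNorm_top_apply_le (T : Lp ℂ 2 μ →L[ℂ] Lp ℂ 2 μ) {g : Lp ℂ 2 μ}
    (hg : eLpNorm g 1 μ ≠ ∞) : eLpNorm (T g) ∞ μ ≤ norm1Inf T * eLpNorm g 1 μ := by
  rcases eq_or_ne g 0 with rfl | hg0
  · rw [map_zero, eLpNorm_congr_ae (Lp.coeFn_zero ℂ 2 μ)]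
    simp
  have hne := Lp_eLpNorm_ne_zero hg0 1 one_ne_zero
  set a : ℝ := (eLpNorm g 1 μ).toReal
  have ha : 0 < a := ENNReal.toReal_pos hne hg
  have hae : ‖((a⁻¹ : ℝ) : ℂ)‖ₑ = (eLpNorm g 1 μ)⁻¹ := by
    rw [← ofReal_norm, Complex.norm_real, Real.norm_of_nonneg (by positivity),
      ENNReal.ofReal_inv_of_pos ha, ENNReal.ofReal_toReal hg]
  have hsc : ∀ (k : Lp ℂ 2 μ) (p : ℝ≥0∞),
      eLpNorm (((a⁻¹ : ℝ) : ℂ) • k : Lp ℂ 2 μ) p μ = (eLpNorm g 1 μ)⁻¹ * eLpNorm k p μ := by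
    intro k p
    rw [eLpNorm_congr_ae (Lp.coeFn_smul _ k), eLpNorm_const_smul, hae]
  have h1 : eLpNorm (((a⁻¹ : ℝ) : ℂ) • g : Lp ℂ 2 μ) 1 μ ≤ 1 := by
    rw [hsc, ENNReal.inv_mul_cancel hne hg]
  have h2 : eLpNorm (T (((a⁻¹ : ℝ) : ℂ) • g)) ∞ μ ≤ norm1Inf T :=
    le_iSup₂ (f := fun (f : Lp ℂ 2 μ) (_ : eLpNorm f 1 μ ≤ 1) => eLpNorm (T f) ∞ μ) _ h1
  rw [map_smul, hsc] at h2
  calc eLpNorm (T g) ∞ μ = (eLpNorm g 1 μ)⁻¹ * eLpNorm (T g) ∞ μ * eLpNorm g 1 μ := by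
        rw [mul_right_comm, ENNReal.inv_mul_cancel hne hg, one_mul]
    _ ≤ norm1Inf T * eLpNorm g 1 μ := by gcongr

theorem enorm_inner_le_eLpNorm (f g : Lp ℂ 2 μ) :
    ‖inner ℂ f g‖ₑ ≤ eLpNorm f ∞ μ * eLpNorm g 1 μ := by
  rw [L2.inner_def]
  refine (enorm_integral_le_lintegral_enorm _).trans ?_
  rw [eLpNorm_one_eq_lintegral_enorm, ← lintegral_const_mul _
    (Lp.stronglyMeasurable g).measurable.enorm]
  refine lintegral_mono_ae ?_
  filter_upwards [enorm_ae_le_eLpNormEssSup f μ] with x hx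
  rw [eLpNorm_exponent_top]
  calc ‖inner ℂ (f x) (g x)‖ₑ ≤ ‖f x‖ₑ * ‖g x‖ₑ := by
        rw [← ofReal_norm, ← ofReal_norm, ← ofReal_norm,
          ← ENNReal.ofReal_mul (norm_nonneg _)]
        exact ENNReal.ofReal_le_ofReal (norm_inner_le_norm _ _)
    _ ≤ _ := by gcongr

theorem enorm_inner_le_eLpNorm_two (f g : Lp ℂ 2 μ) :
    ‖inner ℂ f g‖ₑ ≤ eLpNorm f 2 μ * eLpNorm g 2 μ := by
  rw [Lp_eLpNorm_eq_ofReal, Lp_eLpNorm_eq_ofReal, ← ENNReal.ofReal_mul (norm_nonneg _),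
    ← ofReal_norm]
  exact ENNReal.ofReal_le_ofReal (norm_inner_le_norm _ _)

variable {P Q : Lp ℂ 2 μ →L[ℂ] Lp ℂ 2 μ}

/-- `‖P‖_{1,2}² ≤ ‖P‖_{1,∞}` for a projection. -/
theorem IsStarProjection.eLpNorm_two_sq_le (hP : IsStarProjection P) {g : Lp ℂ 2 μ}
    (hg : eLpNorm g 1 μ ≠ ∞) :
    eLpNorm (P g) 2 μ ^ 2 ≤ norm1Inf P * eLpNorm g 1 μ ^ 2 := by
  have h1 : eLpNorm (P g) 2 μ ^ 2 ≤ ‖inner ℂ (P g) g‖ₑ := by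
    rw [Lp_eLpNorm_sq_eq_ofReal, ← hP.re_inner_apply, ← ofReal_norm]
    exact ENNReal.ofReal_le_ofReal (Complex.re_le_norm _)
  calc eLpNorm (P g) 2 μ ^ 2 ≤ eLpNorm (P g) ∞ μ * eLpNorm g 1 μ :=
        h1.trans (enorm_inner_le_eLpNorm _ _)
    _ ≤ norm1Inf P * eLpNorm g 1 μ * eLpNorm g 1 μ := by
        gcongr; exact eLpNorm_top_apply_le P hg
    _ = _ := by ring

theorem ENNReal.le_rpow_half_mul_of_sq_le {a b c : ℝ≥0∞} (h : a ^ 2 ≤ b * c ^ 2) :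
    a ≤ b ^ (1 / 2 : ℝ) * c := by
  have h2 : (b ^ (1 / 2 : ℝ) * c) ^ 2 = b * c ^ 2 := by
    rw [mul_pow, ← ENNReal.rpow_natCast (b ^ (1 / 2 : ℝ)), ← ENNReal.rpow_mul]
    norm_num
  rw [← h2] at h
  exact (ENNReal.pow_le_pow_left_iff two_ne_zero).1 h

theorem IsStarProjection.eLpNorm_two_le (hP : IsStarProjection P) {g : Lp ℂ 2 μ}
    (hg : eLpNorm g 1 μ ≠ ∞) :
    eLpNorm (P g) 2 μ ≤ norm1Inf P ^ (1 / 2 : ℝ) * eLpNorm g 1 μ :=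
  ENNReal.le_rpow_half_mul_of_sq_le (hP.eLpNorm_two_sq_le hg)

/-- `‖P‖_{2,∞}² ≤ ‖P‖_{1,∞}` for a projection. -/
theorem IsStarProjection.eLpNorm_top_sq_le (hP : IsStarProjection P) (f : Lp ℂ 2 μ) :
    eLpNorm (P f) ∞ μ ^ 2 ≤ norm1Inf P * eLpNorm f 2 μ ^ 2 := by
  have h : eLpNorm (P f) ∞ μ ≤ norm1Inf P ^ (1 / 2 : ℝ) * eLpNorm f 2 μ := by
    refine eLpNorm_top_le_of_inner_le fun g hg => ?_
    rw [hP.inner_apply_left]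
    calc ‖inner ℂ f (P g)‖ₑ ≤ eLpNorm f 2 μ * eLpNorm (P g) 2 μ := enorm_inner_le_eLpNorm_two _ _
      _ ≤ eLpNorm f 2 μ * (norm1Inf P ^ (1 / 2 : ℝ) * eLpNorm g 1 μ) := by
          gcongr; exact hP.eLpNorm_two_le hg
      _ = _ := by ring
  calc eLpNorm (P f) ∞ μ ^ 2 ≤ (norm1Inf P ^ (1 / 2 : ℝ) * eLpNorm f 2 μ) ^ 2 := by gcongr
    _ = _ := by
      rw [mul_pow, ← ENNReal.rpow_natCast (norm1Inf P ^ (1 / 2 : ℝ)), ← ENNReal.rpow_mul]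
      norm_num

/-- `⟨P f, g⟩ = ⟨P f, P g⟩` splits into two `L²` norms, each dominated by its counterpart for `Q`.
Monotonicity of `F` follows. -/
theorem norm1Inf_mono (hP : IsStarProjection P) (hQ : IsStarProjection Q)
    (h : ∀ f, ‖P f‖ ≤ ‖Q f‖) : norm1Inf P ≤ norm1Inf Q := by
  have hle : ∀ f, eLpNorm (P f) 2 μ ≤ eLpNorm (Q f) 2 μ := fun f => by
    rw [Lp_eLpNorm_eq_ofReal, Lp_eLpNorm_eq_ofReal]
    exact ENNReal.ofReal_le_ofReal (h f)
  refine iSup₂_le fun f hf => eLpNorm_top_le_of_inner_le fun g hg => ?_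
  have hf' : eLpNorm f 1 μ ≠ ∞ := (hf.trans_lt ENNReal.one_lt_top).ne
  calc ‖inner ℂ (P f) g‖ₑ = ‖inner ℂ (P f) (P g)‖ₑ := by
        rw [← hP.inner_apply_left, hP.apply_apply]
    _ ≤ eLpNorm (P f) 2 μ * eLpNorm (P g) 2 μ := enorm_inner_le_eLpNorm_two _ _
    _ ≤ (norm1Inf Q ^ (1 / 2 : ℝ) * eLpNorm f 1 μ) * (norm1Inf Q ^ (1 / 2 : ℝ) * eLpNorm g 1 μ) := by
        gcongr
        · exact (hle f).trans (hQ.eLpNorm_two_le hf')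
        · exact (hle g).trans (hQ.eLpNorm_two_le hg)
    _ ≤ (norm1Inf Q ^ (1 / 2 : ℝ) * 1) * (norm1Inf Q ^ (1 / 2 : ℝ) * eLpNorm g 1 μ) := by gcongr
    _ = (norm1Inf Q ^ (1 / 2 : ℝ)) ^ 2 * eLpNorm g 1 μ := by ring
    _ = norm1Inf Q * eLpNorm g 1 μ := by
        rw [← ENNReal.rpow_natCast, ← ENNReal.rpow_mul]
        norm_num

end Ultracontractive

/-! ### From Moser to Nash inequalities by truncation. -/

section Nash

variable {X : Type*} [MeasurableSpace X] {μ : Measure X}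

theorem rcInv_mono (F : ℝ≥0 → ℝ≥0∞) : Monotone (rcInv F) := fun _ _ h =>
  iSup₂_le fun l hl => le_iSup₂ (f := fun (l : ℝ≥0) (_ : F l ≤ _) => (l : ℝ≥0∞)) l (hl.trans h)

theorem ENNReal.div_mul_self_le (a b : ℝ≥0∞) : a / b * b ≤ a := by
  rw [div_eq_mul_inv, mul_assoc]
  exact mul_le_of_le_one_right' (ENNReal.inv_mul_le_one b)

theorem lintegral_enorm_sq_le_add (f : Lp ℂ 2 μ) (t : ℝ≥0∞) :
    eLpNorm f 2 μ ^ 2 ≤ t * eLpNorm f 1 μ + ∫⁻ x in {x | t ≤ ‖f x‖ₑ}, ‖f x‖ₑ ^ 2 ∂μ := by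
  have hm : Measurable f := (Lp.stronglyMeasurable f).measurable
  have hS : MeasurableSet {x | t ≤ ‖f x‖ₑ} := measurableSet_le measurable_const hm.enorm
  rw [eLpNorm_two_sq, ← lintegral_add_compl _ hS, add_comm]
  gcongr
  calc ∫⁻ x in {x | t ≤ ‖f x‖ₑ}ᶜ, ‖f x‖ₑ ^ 2 ∂μ ≤ ∫⁻ x in {x | t ≤ ‖f x‖ₑ}ᶜ, t * ‖f x‖ₑ ∂μ := by
        refine setLIntegral_mono' hS.compl fun x hx => ?_
        rw [sq]
        gcongr
        exact le_of_lt (not_le.1 (show ¬ t ≤ ‖f x‖ₑ from hx))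
    _ ≤ ∫⁻ x, t * ‖f x‖ₑ ∂μ := setLIntegral_le_lintegral _ _
    _ = t * eLpNorm f 1 μ := by
        rw [lintegral_const_mul _ hm.enorm, eLpNorm_one_eq_lintegral_enorm]

/-- A Nash-type bound from a Moser-type bound: truncate at the height `t`. -/
theorem mul_rcInv_le_of_lintegral_le (f : Lp ℂ 2 μ) (Φ : ℝ≥0 → ℝ≥0∞) {B t z : ℝ≥0∞}
    {y : X → ℝ≥0∞} (hB : ∫⁻ x, ‖f x‖ₑ ^ 2 * rcInv Φ (y x) ∂μ ≤ B)
    (hy : ∀ x, t ≤ ‖f x‖ₑ → z ≤ y x) :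
    (eLpNorm f 2 μ ^ 2 - t * eLpNorm f 1 μ) * rcInv Φ z ≤ B := by
  have hm : Measurable f := (Lp.stronglyMeasurable f).measurable
  have hS : MeasurableSet {x | t ≤ ‖f x‖ₑ} := measurableSet_le measurable_const hm.enorm
  calc _ ≤ (∫⁻ x in {x | t ≤ ‖f x‖ₑ}, ‖f x‖ₑ ^ 2 ∂μ) * rcInv Φ z := by
        gcongr
        exact tsub_le_iff_left.2 (lintegral_enorm_sq_le_add f t)
    _ = ∫⁻ x in {x | t ≤ ‖f x‖ₑ}, ‖f x‖ₑ ^ 2 * rcInv Φ z ∂μ := by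
        rw [lintegral_mul_const _ (hm.enorm.pow_const 2)]
    _ ≤ ∫⁻ x in {x | t ≤ ‖f x‖ₑ}, ‖f x‖ₑ ^ 2 * rcInv Φ (y x) ∂μ :=
        setLIntegral_mono' hS fun x hx => mul_le_mul_right (rcInv_mono Φ (hy x hx)) _
    _ ≤ B := (setLIntegral_le_lintegral _ _).trans hB

theorem nash_of_moserOne {f : Lp ℂ 2 μ} (hf : f ≠ 0) {Φ : ℝ≥0 → ℝ≥0∞} {e : ℝ≥0∞}
    (h : MoserOne Φ e f) : NashIneq Φ e f := by
  have h10 := Lp_eLpNorm_ne_zero hf 1 one_ne_zero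
  set a := eLpNorm f 2 μ ^ 2 with ha
  have hatop : a ≠ ∞ := ENNReal.pow_ne_top (Lp.eLpNorm_ne_top f)
  set b := eLpNorm f 1 μ with hb
  have key : a / 2 * rcInv Φ (a / (4 * b ^ 2)) ≤ 4 * e := by
    -- At the height `‖f‖₂² / (2 ‖f‖₁)` truncation loses at most half of `‖f‖₂²`. If `f ∉ L¹` the
    -- height is `0`.
    refine le_trans ?_ (mul_rcInv_le_of_lintegral_le f Φ (t := a / (2 * b))
      (z := a / (4 * b ^ 2)) h fun x hx => ?_)
    · rw [← ha, ← hb]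
      refine mul_le_mul_left ?_ _
      have h1 : a / (2 * b) * b ≤ a / 2 := by
        rw [div_eq_mul_inv, ENNReal.mul_inv (by simp) (by simp), ← mul_assoc, ← div_eq_mul_inv,
          ← div_eq_mul_inv]
        exact ENNReal.div_mul_self_le _ _
      exact (ENNReal.sub_half hatop).ge.trans (tsub_le_tsub_left h1 a)
    · calc a / (4 * b ^ 2) = a / (2 * b) / (2 * b) := by
            rw [show 4 * b ^ 2 = (2 * b) * (2 * b) by ring]
            rcases eq_or_ne b ∞ with hbt | hbt
            · simp [hbt]
            · rw [div_eq_mul_inv, div_eq_mul_inv, div_eq_mul_inv,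
                ENNReal.mul_inv (Or.inl (by simp [h10])) (Or.inl (ENNReal.mul_ne_top (by simp) hbt)),
                mul_assoc]
        _ ≤ ‖f x‖ₑ / (2 * b) := by gcongr
  calc a * rcInv Φ (a / (4 * b ^ 2)) = 2 * (a / 2 * rcInv Φ (a / (4 * b ^ 2))) := by
        rw [← mul_assoc, ENNReal.mul_div_cancel (by simp) (by simp)]
    _ ≤ 2 * (4 * e) := by gcongr
    _ = 8 * e := by ring

theorem weakNash_of_moserTwo {f : Lp ℂ 2 μ} (hf : f ≠ 0) {Φ : ℝ≥0 → ℝ≥0∞} {e : ℝ≥0∞}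
    (h : MoserTwo Φ e f) : WeakNashIneq Φ e f := by
  intro ε hε hε2
  have h10 := Lp_eLpNorm_ne_zero hf 1 one_ne_zero
  have h20 := Lp_eLpNorm_ne_zero hf 2 two_ne_zero
  set a := eLpNorm f 2 μ with ha
  have hatop : a ≠ ∞ := Lp.eLpNorm_ne_top f
  set b := eLpNorm f 1 μ with hb
  set c := ENNReal.ofReal ε with hc
  have key : (2 * ENNReal.ofReal (1 / 2 - ε) * a ^ 2) *
      rcInv Φ (ENNReal.ofReal (ε ^ 2) * a ^ 2 / b ^ 2) ≤ 4 * e := by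
    -- The height `t = 2ε ‖f‖₂² / ‖f‖₁` leaves at least `(1 - 2ε) ‖f‖₂²`, and `t² / (4 ‖f‖₂²)` is
    -- exactly `ε² ‖f‖₂² / ‖f‖₁²`.
    refine le_trans ?_ (mul_rcInv_le_of_lintegral_le f Φ (t := 2 * c * a ^ 2 / b)
      (z := ENNReal.ofReal (ε ^ 2) * a ^ 2 / b ^ 2) h fun x hx => ?_)
    · rw [← ha, ← hb]
      refine mul_le_mul_left ?_ _
      have h2 : 2 * ENNReal.ofReal (1 / 2 - ε) = 1 - 2 * c := by
        rw [hc, show (2 : ℝ≥0∞) = ENNReal.ofReal 2 by simp, ← ENNReal.ofReal_one,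
          ← ENNReal.ofReal_mul (by norm_num), ← ENNReal.ofReal_mul (by norm_num),
          ← ENNReal.ofReal_sub _ (by positivity)]
        congr 1
        ring
      rw [h2, ENNReal.sub_mul (fun _ _ => ENNReal.pow_ne_top hatop), one_mul]
      exact tsub_le_tsub_left (ENNReal.div_mul_self_le _ _) _
    · have hx2 : (2 * c * a ^ 2 / b) ^ 2 ≤ ‖f x‖ₑ ^ 2 := by gcongr
      refine le_trans (le_of_eq ?_) (ENNReal.div_le_div_right hx2 _)
      rw [ENNReal.ofReal_pow hε.le, ← hc, div_eq_mul_inv, div_eq_mul_inv, div_eq_mul_inv, mul_pow,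
        ENNReal.inv_pow]
      rw [ENNReal.mul_inv (by simp) (by simp)]
      have e1 : a ^ 2 * (a ^ 2)⁻¹ = 1 :=
        ENNReal.mul_inv_cancel (pow_ne_zero 2 h20) (ENNReal.pow_ne_top hatop)
      have e2 : (4 : ℝ≥0∞) * 4⁻¹ = 1 := ENNReal.mul_inv_cancel (by simp) (by simp)
      calc c ^ 2 * a ^ 2 * b⁻¹ ^ 2
          = c ^ 2 * a ^ 2 * b⁻¹ ^ 2 * (a ^ 2 * (a ^ 2)⁻¹) * ((4 : ℝ≥0∞) * 4⁻¹) := by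
            rw [e1, e2, mul_one, mul_one]
        _ = _ := by ring
  have hcalc : 2 * (ENNReal.ofReal (1 / 2 - ε) * a ^ 2 *
      rcInv Φ (ENNReal.ofReal (ε ^ 2) * a ^ 2 / b ^ 2)) ≤ 2 * (2 * e) := by
    calc _ = (2 * ENNReal.ofReal (1 / 2 - ε) * a ^ 2) *
          rcInv Φ (ENNReal.ofReal (ε ^ 2) * a ^ 2 / b ^ 2) := by ring
      _ ≤ 4 * e := key
      _ = 2 * (2 * e) := by ring
  exact (ENNReal.mul_le_mul_iff_right (by simp) (by simp)).1 hcalc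

end Nash

/-! ### The layer-cake argument for Moser inequalities. -/

section Moser

variable {X : Type*} [MeasurableSpace X] {μ : Measure X}

/-- Layer cake for `max u 0`: the tail `]t, ∞[` of the spectral measure has mass `‖f - E_t f‖²`. -/
theorem energy_eq_lintegral {H : Type*} [NormedAddCommGroup H] [InnerProductSpace ℂ H]
    [CompleteSpace H] (A : H →ₗ.[ℂ] H) (f : H) :
    energy A f = ∫⁻ t in Set.Ioi (0 : ℝ),
      ENNReal.ofReal (‖f - (spectralFamily A).toFun t f‖ ^ 2) := by
  have h := lintegral_eq_lintegral_meas_lt (f := fun u : ℝ => max u 0)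
    ((spectralFamily A).scalarMeasure f) (Eventually.of_forall fun u => le_max_right u 0)
    (by fun_prop)
  have h0 : energy A f = ∫⁻ u, ENNReal.ofReal (max u 0) ∂((spectralFamily A).scalarMeasure f) := by
    refine lintegral_congr fun u => ?_
    rcases le_total u 0 with hu | hu
    · rw [max_eq_right hu, ENNReal.ofReal_of_nonpos hu, ENNReal.ofReal_zero]
    · rw [max_eq_left hu]
  rw [h0, h]
  refine setLIntegral_congr_fun measurableSet_Ioi fun t ht => ?_
  have ht' : 0 < t := ht
  rw [← ResolutionOfIdentity.scalarMeasure_Ioi]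
  congr 1
  ext u
  simp [ht'.not_gt]

theorem rcInv_le_volume {F : ℝ≥0 → ℝ≥0∞} (hF : Monotone F) (y : ℝ≥0∞) :
    rcInv F y ≤ volume ({t : ℝ | F t.toNNReal ≤ y} ∩ Set.Ioi 0) := by
  refine iSup₂_le fun l hl => ?_
  calc (l : ℝ≥0∞) = volume (Set.Ioc (0 : ℝ) l) := by simp
    _ ≤ _ := measure_mono fun t ht =>
        Set.mem_inter ((hF (Real.toNNReal_le_iff_le_coe.2 ht.2)).trans hl) ht.1

theorem lintegral_mul_rcInv_le (f : Lp ℂ 2 μ) {F : ℝ≥0 → ℝ≥0∞} (hF : Monotone F)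
    {y : X → ℝ≥0∞} (hy : Measurable y) {D : ℝ → ℝ≥0∞}
    (h : ∀ t : ℝ, 0 < t → ∫⁻ x in {x | F t.toNNReal ≤ y x}, ‖f x‖ₑ ^ 2 ∂μ ≤ 4 * D t)  :
    ∫⁻ x, ‖f x‖ₑ ^ 2 * rcInv F (y x) ∂μ ≤ 4 * ∫⁻ t in Set.Ioi 0, D t := by
  have hm : Measurable fun x => ‖f x‖ₑ ^ 2 := (Lp.stronglyMeasurable f).measurable.enorm.pow_const 2
  set ν := μ.withDensity fun x => ‖f x‖ₑ ^ 2 with hν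
  -- Finiteness of `|f|² μ` allows Tonelli even when `μ` is not σ-finite.
  have hνfin : IsFiniteMeasure ν := ⟨by
    rw [hν, withDensity_apply _ MeasurableSet.univ, Measure.restrict_univ, ← eLpNorm_two_sq]
    exact (ENNReal.pow_ne_top (Lp.eLpNorm_ne_top f)).lt_top⟩
  have hFm : Measurable fun t : ℝ => F t.toNNReal := hF.measurable.comp measurable_real_toNNReal
  let S : Set (X × ℝ) := {p | F p.2.toNNReal ≤ y p.1}
  have hS : MeasurableSet S :=
    measurableSet_le (hFm.comp measurable_snd) (hy.comp measurable_fst)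
  have hSm : Measurable (S.indicator (1 : X × ℝ → ℝ≥0∞)) := measurable_one.indicator hS
  have hinner : ∀ x, ∫⁻ t in Set.Ioi 0, S.indicator 1 (x, t) =
      volume ({t : ℝ | F t.toNNReal ≤ y x} ∩ Set.Ioi 0) := by
    intro x
    have hSx : MeasurableSet {t : ℝ | F t.toNNReal ≤ y x} := measurableSet_le hFm measurable_const
    rw [← Measure.restrict_apply hSx, ← lintegral_indicator_one hSx]
    rfl
  have hinner2 : ∀ t : ℝ, ∫⁻ x, S.indicator 1 (x, t) ∂ν =
      ∫⁻ x in {x | F t.toNNReal ≤ y x}, ‖f x‖ₑ ^ 2 ∂μ := by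
    intro t
    have hSt : MeasurableSet {x | F t.toNNReal ≤ y x} := measurableSet_le measurable_const hy
    rw [← withDensity_apply _ hSt, ← lintegral_indicator_one hSt]
    rfl
  calc ∫⁻ x, ‖f x‖ₑ ^ 2 * rcInv F (y x) ∂μ
      ≤ ∫⁻ x, ‖f x‖ₑ ^ 2 * (∫⁻ t in Set.Ioi 0, S.indicator 1 (x, t)) ∂μ := by
        gcongr with x
        rw [hinner]
        exact rcInv_le_volume hF _
    _ = ∫⁻ x, (∫⁻ t in Set.Ioi 0, S.indicator 1 (x, t)) ∂ν :=
        (lintegral_withDensity_eq_lintegral_mul _ hm hSm.lintegral_prod_right').symm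
    _ = ∫⁻ t in Set.Ioi 0, ∫⁻ x, S.indicator 1 (x, t) ∂ν :=
        lintegral_lintegral_swap hSm.aemeasurable
    _ ≤ ∫⁻ t in Set.Ioi 0, 4 * D t := by
        refine setLIntegral_mono' measurableSet_Ioi fun t ht => ?_
        rw [hinner2]
        exact h t ht
    _ = 4 * ∫⁻ t in Set.Ioi 0, D t := lintegral_const_mul' _ _ (by simp)

theorem enorm_le_two_mul_enorm_sub {z w : ℂ} (h : 2 * ‖w‖ₑ ≤ ‖z‖ₑ) : ‖z‖ₑ ≤ 2 * ‖z - w‖ₑ := by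
  have h1 : ‖z‖ₑ ≤ ‖z - w‖ₑ + ‖w‖ₑ := by simpa using enorm_add_le (z - w) w
  refine (ENNReal.add_le_add_iff_right (enorm_ne_top (x := z))).1 ?_
  calc ‖z‖ₑ + ‖z‖ₑ = 2 * ‖z‖ₑ := (two_mul _).symm
    _ ≤ 2 * (‖z - w‖ₑ + ‖w‖ₑ) := by gcongr
    _ = 2 * ‖z - w‖ₑ + 2 * ‖w‖ₑ := mul_add _ _ _
    _ ≤ 2 * ‖z - w‖ₑ + ‖z‖ₑ := by gcongr

theorem setLIntegral_enorm_sq_le (f g : Lp ℂ 2 μ) {S : Set X} (hS : MeasurableSet S)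
    (h : ∀ᵐ x ∂μ, x ∈ S → 2 * ‖g x‖ₑ ≤ ‖f x‖ₑ) :
    ∫⁻ x in S, ‖f x‖ₑ ^ 2 ∂μ ≤ 4 * ENNReal.ofReal (‖f - g‖ ^ 2) := by
  rw [← Lp_eLpNorm_sq_eq_ofReal, eLpNorm_two_sq,
    ← lintegral_const_mul _ ((Lp.stronglyMeasurable _).measurable.enorm.pow_const 2)]
  refine le_trans ?_ (setLIntegral_le_lintegral S _)
  refine setLIntegral_mono_ae' hS ?_
  filter_upwards [h, Lp.coeFn_sub f g] with x hx hsub hxS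
  rw [hsub, Pi.sub_apply, show (4 : ℝ≥0∞) = 2 ^ 2 by norm_num, ← mul_pow]
  gcongr
  exact enorm_le_two_mul_enorm_sub (hx hxS)

end Moser

/-! ### Moser and Faber–Krahn inequalities for a family of projections. -/

section Main

variable {X : Type*} [MeasurableSpace X] {μ : Measure X}

theorem eLpNorm_one_sq_le_of_support {f : Lp ℂ 2 μ} {Ω : Set X} (hΩ : MeasurableSet Ω)
    (hf : ∀ᵐ x ∂μ, x ∉ Ω → f x = 0) : eLpNorm f 1 μ ^ 2 ≤ μ Ω * eLpNorm f 2 μ ^ 2 := by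
  have hind : f =ᵐ[μ] Ω.indicator f := by
    filter_upwards [hf] with x hx
    by_cases h : x ∈ Ω
    · simp [h]
    · simp [h, hx h]
  have h1 : eLpNorm f 1 μ = eLpNorm f 1 (μ.restrict Ω) := by
    rw [eLpNorm_congr_ae hind, eLpNorm_indicator_eq_eLpNorm_restrict hΩ]
  have h2 := eLpNorm_le_eLpNorm_mul_rpow_measure_univ (p := 1) (q := 2) (μ := μ.restrict Ω)
    (f := f) one_le_two (Lp.aestronglyMeasurable f).restrict
  rw [Measure.restrict_apply MeasurableSet.univ, Set.univ_inter, ← h1] at h2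
  have h3 : eLpNorm f 1 μ ≤ eLpNorm f 2 μ * μ Ω ^ (1 / 2 : ℝ) := by
    rw [show 1 / ENNReal.toReal 1 - 1 / ENNReal.toReal 2 = (1 / 2 : ℝ) by norm_num] at h2
    refine h2.trans ?_
    gcongr
    exact Measure.restrict_le_self
  calc eLpNorm f 1 μ ^ 2 ≤ (eLpNorm f 2 μ * μ Ω ^ (1 / 2 : ℝ)) ^ 2 := by gcongr
    _ = μ Ω * eLpNorm f 2 μ ^ 2 := by
      rw [mul_pow, ← ENNReal.rpow_natCast (μ Ω ^ (1 / 2 : ℝ)), ← ENNReal.rpow_mul, mul_comm]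
      norm_num

/-- Chebyshev's inequality for the spectral measure. -/
theorem norm_sub_spectralFamily_sq_le {H : Type*} [NormedAddCommGroup H] [InnerProductSpace ℂ H]
    [CompleteSpace H] (A : H →ₗ.[ℂ] H) {f : H} (hf : f ≠ 0) (hE : energy A f < ∞) {c : ℝ}
    (hc : 0 < c) :
    ‖f - (spectralFamily A).toFun (c * (energy A f).toReal / ‖f‖ ^ 2) f‖ ^ 2 ≤ ‖f‖ ^ 2 / c := by
  set E := spectralFamily A
  set e := (energy A f).toReal with he
  have hn : 0 < ‖f‖ ^ 2 := by positivity
  -- With zero energy the level is `0` and Chebyshev cannot divide by it; there the spectral measure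
  -- has no mass on `]0, ∞[`, so `E_0 f = f`.
  rcases (ENNReal.toReal_nonneg (a := energy A f)).eq_or_lt with h0 | h0
  · rw [← he] at h0
    have hz : energy A f = 0 := by
      rw [← ENNReal.ofReal_toReal hE.ne, ← he, ← h0, ENNReal.ofReal_zero]
    have hae : ∀ᵐ u ∂E.scalarMeasure f, u ≤ 0 := by
      filter_upwards [(lintegral_eq_zero_iff (by fun_prop)).1 hz] with u hu
      exact ENNReal.ofReal_eq_zero.1 hu
    have hIoi : E.scalarMeasure f (Set.Ioi 0) = 0 := by
      rw [ae_iff] at hae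
      simp only [not_le] at hae
      exact hae
    rw [E.scalarMeasure_Ioi, ENNReal.ofReal_eq_zero] at hIoi
    rw [← h0, mul_zero, zero_div]
    exact hIoi.trans (by positivity)
  · rw [← he] at h0
    set l := c * e / ‖f‖ ^ 2 with hl
    have hlpos : 0 < l := by positivity
    have h1 : ENNReal.ofReal (l * ‖f - E.toFun l f‖ ^ 2) ≤ energy A f := by
      rw [ENNReal.ofReal_mul hlpos.le, ← E.scalarMeasure_Ioi, ← setLIntegral_const]
      refine (setLIntegral_mono' measurableSet_Ioi fun u hu => ?_).trans
        (setLIntegral_le_lintegral _ _)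
      exact ENNReal.ofReal_le_ofReal (le_of_lt hu)
    have h2 : l * ‖f - E.toFun l f‖ ^ 2 ≤ e := (ENNReal.ofReal_le_iff_le_toReal hE.ne).1 h1
    have h3 : l * (‖f‖ ^ 2 / c) = e := by rw [hl]; field_simp
    rw [← h3] at h2
    exact le_of_mul_le_mul_left h2 hlpos

variable {f : Lp ℂ 2 μ} {A : Lp ℂ 2 μ →ₗ.[ℂ] Lp ℂ 2 μ} {T : ℝ≥0 → Lp ℂ 2 μ →L[ℂ] Lp ℂ 2 μ}

theorem moser_of_pointwise (hmono : Monotone fun l => norm1Inf (T l))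
    (hT : ∀ l : ℝ≥0, T l f = (spectralFamily A).toFun l f) {y : X → ℝ≥0∞} (hy : Measurable y)
    (h : ∀ l : ℝ≥0, ∀ᵐ x ∂μ, norm1Inf (T l) ≤ y x → 2 * ‖T l f x‖ₑ ≤ ‖f x‖ₑ) :
    ∫⁻ x, ‖f x‖ₑ ^ 2 * rcInv (fun l => norm1Inf (T l)) (y x) ∂μ ≤ 4 * energy A f := by
  rw [energy_eq_lintegral]
  refine lintegral_mul_rcInv_le f hmono hy fun t ht => ?_
  have hTt := hT t.toNNReal
  rw [Real.coe_toNNReal t ht.le] at hTt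
  rw [← hTt]
  exact setLIntegral_enorm_sq_le _ _ (measurableSet_le measurable_const hy) (h _)

theorem moserTwo_of_projections (hf : f ≠ 0) (hmono : Monotone fun l => norm1Inf (T l))
    (hproj : ∀ l, IsStarProjection (T l))
    (hT : ∀ l : ℝ≥0, T l f = (spectralFamily A).toFun l f) :
    MoserTwo (fun l => norm1Inf (T l)) (energy A f) f := by
  have hm : Measurable fun x => ‖f x‖ₑ := (Lp.stronglyMeasurable f).measurable.enorm
  have h20 := Lp_eLpNorm_ne_zero hf 2 two_ne_zero
  refine moser_of_pointwise hmono hT ((hm.pow_const 2).div_const _) fun l => ?_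
  filter_upwards [enorm_ae_le_eLpNormEssSup (T l f) μ] with x hx hle
  rw [← eLpNorm_exponent_top] at hx
  rw [ENNReal.le_div_iff_mul_le (Or.inl (by simp [h20]))
    (Or.inl (ENNReal.mul_ne_top (by simp) (ENNReal.pow_ne_top (Lp.eLpNorm_ne_top f))))] at hle
  refine (ENNReal.pow_le_pow_left_iff two_ne_zero).1 (le_trans ?_ hle)
  calc (2 * ‖T l f x‖ₑ) ^ 2 = 4 * ‖T l f x‖ₑ ^ 2 := by ring
    _ ≤ 4 * (norm1Inf (T l) * eLpNorm f 2 μ ^ 2) := by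
        gcongr
        exact (ENNReal.pow_le_pow_left hx).trans ((hproj l).eLpNorm_top_sq_le f)
    _ = _ := by ring

theorem moserOne_of_projections (hf : f ≠ 0) (hmono : Monotone fun l => norm1Inf (T l))
    (hproj : ∀ l, IsStarProjection (T l))
    (hT : ∀ l : ℝ≥0, T l f = (spectralFamily A).toFun l f) :
    MoserOne (fun l => norm1Inf (T l)) (energy A f) f := by
  have hm : Measurable fun x => ‖f x‖ₑ := (Lp.stronglyMeasurable f).measurable.enorm
  have h10 := Lp_eLpNorm_ne_zero hf 1 one_ne_zero
  refine moser_of_pointwise hmono hT (hm.div_const _) fun l => ?_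
  filter_upwards [enorm_ae_le_eLpNormEssSup (T l f) μ] with x hx hle
  rw [← eLpNorm_exponent_top] at hx
  -- If `f ∉ L¹` then `y = 0`, so `F l = 0`, and the `L² → L^∞` bound makes `T l f` vanish.
  rcases eq_or_ne (eLpNorm f 1 μ) ∞ with htop | htop
  · rw [htop, ENNReal.mul_top (by simp), ENNReal.div_top, nonpos_iff_eq_zero] at hle
    have h0 := (hproj l).eLpNorm_top_sq_le f
    rw [hle, zero_mul, nonpos_iff_eq_zero, pow_eq_zero_iff two_ne_zero] at h0
    rw [h0, nonpos_iff_eq_zero] at hx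
    rw [hx, mul_zero]
    exact zero_le
  · rw [ENNReal.le_div_iff_mul_le (Or.inl (by simp [h10]))
      (Or.inl (ENNReal.mul_ne_top (by simp) htop))] at hle
    calc 2 * ‖T l f x‖ₑ ≤ 2 * (norm1Inf (T l) * eLpNorm f 1 μ) := by
          gcongr
          exact hx.trans (eLpNorm_top_apply_le (T l) htop)
      _ = norm1Inf (T l) * (2 * eLpNorm f 1 μ) := by ring
      _ ≤ ‖f x‖ₑ := hle

theorem faberKrahn_of_projections (hf : f ≠ 0) (hproj : ∀ l, IsStarProjection (T l))
    (hT : ∀ l : ℝ≥0, T l f = (spectralFamily A).toFun l f) {Ω : Set X} (hΩ : MeasurableSet Ω)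
    (hΩfin : μ Ω < ∞) (hsupp : ∀ᵐ x ∂μ, x ∉ Ω → f x = 0) (hE : energy A f < ∞) :
    1 ≤ 4 * μ Ω * norm1Inf (T (8 * energy A f / eLpNorm f 2 μ ^ 2).toNNReal) := by
  set l := (8 * energy A f / eLpNorm f 2 μ ^ 2).toNNReal with hl
  have hn : 0 < ‖f‖ ^ 2 := by positivity
  have hlr : (l : ℝ) = 8 * (energy A f).toReal / ‖f‖ ^ 2 := by
    rw [hl, ENNReal.coe_toNNReal_eq_toReal, ENNReal.toReal_div, ENNReal.toReal_mul,
      Lp_eLpNorm_sq_eq_ofReal, ENNReal.toReal_ofReal hn.le]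
    norm_num
  -- This gives `‖T l f‖² ≥ (7/8) ‖f‖²`, more than the `1/4` used below.
  have hcheb := norm_sub_spectralFamily_sq_le A hf hE (c := 8) (by norm_num)
  rw [← hlr, ← hT, (hproj l).norm_sub_apply_sq] at hcheb
  have h1 := eLpNorm_one_sq_le_of_support hΩ hsupp
  have h2top : eLpNorm f 2 μ ^ 2 ≠ ∞ := ENNReal.pow_ne_top (Lp.eLpNorm_ne_top f)
  have h20 : eLpNorm f 2 μ ^ 2 ≠ 0 := pow_ne_zero 2 (Lp_eLpNorm_ne_zero hf 2 two_ne_zero)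
  have h1top : eLpNorm f 1 μ ≠ ∞ := fun h => by
    rw [h, ENNReal.top_pow two_ne_zero] at h1
    exact ENNReal.mul_ne_top hΩfin.ne h2top (top_le_iff.1 h1)
  refine (ENNReal.mul_le_mul_iff_left h20 h2top).1 ?_
  calc 1 * eLpNorm f 2 μ ^ 2 ≤ 4 * eLpNorm (T l f) 2 μ ^ 2 := by
        rw [one_mul, Lp_eLpNorm_sq_eq_ofReal, Lp_eLpNorm_sq_eq_ofReal,
          show (4 : ℝ≥0∞) = ENNReal.ofReal 4 by simp, ← ENNReal.ofReal_mul (by norm_num)]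
        exact ENNReal.ofReal_le_ofReal (by linarith)
    _ ≤ 4 * (norm1Inf (T l) * (μ Ω * eLpNorm f 2 μ ^ 2)) := by
        gcongr
        exact ((hproj l).eLpNorm_two_sq_le h1top).trans (by gcongr)
    _ = _ := by ring

end Main

/-! ### Differences of spectral projections. -/

section SpectralProjections

variable {H : Type*} [NormedAddCommGroup H] [InnerProductSpace ℂ H] [CompleteSpace H]

theorem ResolutionOfIdentity.isStarProjection_sub (E : ResolutionOfIdentity H) {u v : ℝ}
    (h : u ≤ v) : IsStarProjection (E.toFun v - E.toFun u) := by
  refine ⟨?_, (E.isProj v).isSelfAdjoint.sub (E.isProj u).isSelfAdjoint⟩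
  ext f
  simp only [mul_apply_eq_comp, sub_apply, map_sub]
  rw [E.mono v v le_rfl, E.mono u u le_rfl, E.mono u v h, E.apply_apply_of_le h]
  abel

theorem ResolutionOfIdentity.norm_sub_mono (E : ResolutionOfIdentity H) {u v w : ℝ}
    (h : u ≤ v) (h' : v ≤ w) (f : H) :
    ‖(E.toFun v - E.toFun u) f‖ ≤ ‖(E.toFun w - E.toFun u) f‖ := by
  simp only [sub_apply]
  refine (pow_le_pow_iff_left₀ (norm_nonneg _) (norm_nonneg _) two_ne_zero).1 ?_
  rw [E.norm_sub_sq h, E.norm_sub_sq (h.trans h')]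
  have := E.norm_apply_mono h' f
  gcongr

end SpectralProjections

end

theorem mainTheorem7 {X : Type*} [MeasurableSpace X] (μ : Measure X)
    (A : Lp ℂ 2 μ →ₗ.[ℂ] Lp ℂ 2 μ) (hA : IsSelfAdjoint A) (hpos : OpNonneg A)
    (f : Lp ℂ 2 μ) (hf : f ≠ 0) (F : ℝ≥0 → ℝ≥0∞)
    (hF : (f ∈ (opKer A)ᗮ ∧ F = fun l => norm1Inf (spectralProjIoc A l)) ∨
      F = fun l => norm1Inf (spectralProjIcc A l)) :
    MoserTwo F (energy A f) f ∧
    MoserOne F (energy A f) f ∧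
    NashIneq F (energy A f) f ∧
    (∀ (Φ : ℝ≥0 → ℝ≥0∞) (e : ℝ≥0∞), Monotone Φ →
      (MoserOne Φ e f → NashIneq Φ e f) ∧ (MoserTwo Φ e f → WeakNashIneq Φ e f)) ∧
    (∀ Ω : Set X, MeasurableSet Ω → μ Ω < ∞ → (∀ᵐ x ∂μ, x ∉ Ω → f x = 0) →
      energy A f < ∞ →
      1 ≤ 4 * μ Ω * F (8 * energy A f / eLpNorm f 2 μ ^ 2).toNNReal) := by
  -- Both alternatives reduce to an increasing family of projections that agrees with `E_l` on `f`.
  obtain ⟨T, rfl, hproj, hnorm, hT⟩ : ∃ T : ℝ≥0 → Lp ℂ 2 μ →L[ℂ] Lp ℂ 2 μ,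
      F = (fun l => norm1Inf (T l)) ∧ (∀ l, IsStarProjection (T l)) ∧
      (∀ l l', l ≤ l' → ∀ g, ‖T l g‖ ≤ ‖T l' g‖) ∧
      ∀ l : ℝ≥0, T l f = (spectralFamily A).toFun l f := by
    rcases hF with ⟨hker, rfl⟩ | rfl
    · refine ⟨spectralProjIoc A, rfl,
        fun l => (spectralFamily A).isStarProjection_sub l.coe_nonneg,
        fun l l' h g => (spectralFamily A).norm_sub_mono l.coe_nonneg (NNReal.coe_le_coe.2 h) g,
        fun l => ?_⟩
      rw [spectralProjIoc, sub_apply,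
        spectralFamily_zero_apply_of_mem_orthogonal_ker hA hpos hker, sub_zero]
    · exact ⟨spectralProjIcc A, rfl, fun l => (spectralFamily A).isProj l,
        fun l l' h g => (spectralFamily A).norm_apply_mono (NNReal.coe_le_coe.2 h) g,
        fun _ => rfl⟩
  have hmono : Monotone fun l => norm1Inf (T l) := fun l l' h =>
    norm1Inf_mono (hproj l) (hproj l') (hnorm l l' h)
  have hone := moserOne_of_projections hf hmono hproj hT
  exact ⟨moserTwo_of_projections hf hmono hproj hT, hone, nash_of_moserOne hf hone,
    fun Φ e _ => ⟨nash_of_moserOne hf, weakNash_of_moserTwo hf⟩,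
    fun Ω hΩ hfin hsupp hE => faberKrahn_of_projections hf hproj hT hΩ hfin hsupp hE⟩
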